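/- Let $(R,\mathfrak{m},k)$ be a commutative Noetherian local ring of dimension $d$ that is Cohen-Macaulay and has minimal multiplicity, i.e. $e(R)=\mu(\mathfrak{m})-d+1$, where $\mu(\mathfrak{m})$ is the minimal number of generators of $\mathfrak{m}$ and $e(R)$ is the multiplicity of $R$ ($d!$ times the leading coefficient of the polynomial $P$ with $P(n)=\lambda_R(R/\mathfrak{m}^{n+1})$ for all $n\gg 0$, where $\lambda_R$ denotes length). For $n\ge 0$ let $\Omega_n^R(k)$ be the $n$th syzygy module of $k$, i.e. the image of the $n$th differential of an augmented minimal free resolution $\cdots\to F_1\to F_0\to k\to 0$ of $k$; the $0$th differential is $F_0\to k$, so $\Omega_0^R(k)=k$. Suppose that there is a surjective $R$-linear map $$\bigoplus_{i=1}^{r}\Omega_{n_i}^R(k)\longrightarrow L$$ from a finite direct sum of syzygy modules of $k$ (with $r\ge 0$ and $n_1,\dots,n_r\ge 0$, repetitions allowed) onto a non-zero $R$-module $L$ of G-dimension zero, i.e. such that, with $(-)^*=\operatorname{Hom}_R(-,R)$, the natural map $L\to L^{**}$ is an isomorphism and $\operatorname{Ext}_R^i(L,R)=0=\operatorname{Ext}_R^i(L^*,R)$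 for all $i\ge 1$. Then $R$ is Gorenstein, i.e. $R$ has finite injective dimension as a module over itself. -/

import Mathlib

open CategoryTheory CategoryTheory.Abelian IsLocalRing

universe u

/-- The depth of a local ring `R`: the supremum of the lengths of `R`-regular sequences
contained in the maximal ideal. -/
noncomputable def localRingDepth (R : Type u) [CommRing R] [IsLocalRing R] : ℕ∞ :=
  ⨆ rs : {rs : List R // (∀ r ∈ rs, r ∈ maximalIdeal R) ∧ RingTheory.Sequence.IsRegular R rs},
    (rs.1.length : ℕ∞)

/-- A Noetherian local ring is Cohen-Macaulay if its depth equals its Krull dimension. -/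
def IsCohenMacaulayLocal (R : Type u) [CommRing R] [IsLocalRing R] [IsNoetherianRing R] : Prop :=
  (localRingDepth R : WithBot ℕ∞) = ringKrullDim R

/-- A Noetherian local ring is Gorenstein if it has finite injective dimension as a module
over itself. -/
def IsGorensteinLocal (R : Type u) [CommRing R] [IsLocalRing R] [IsNoetherianRing R] : Prop :=
  ∃ n : ℕ, HasInjectiveDimensionLE (ModuleCat.of R R) n

/-- `P` is the Hilbert-Samuel polynomial of the local ring `R`: `P(n)` is the length of
`R / 𝔪 ^ (n + 1)` for all `n ≫ 0`. (These lengths are finite because `R` is Noetherian, and there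
is exactly one such polynomial.) -/
def IsHilbertSamuelPolynomial (R : Type u) [CommRing R] [IsLocalRing R] [IsNoetherianRing R]
    (P : Polynomial ℚ) : Prop :=
  ∀ᶠ n : ℕ in Filter.atTop,
    P.eval (n : ℚ) = ((Module.length R (R ⧸ maximalIdeal R ^ (n + 1))).toNat : ℚ)

/-- `e` is the multiplicity of the local ring `R`: if `d = dim R`, then `e` is `d !` times the
leading coefficient of the Hilbert-Samuel polynomial of `R`. -/
def IsMultiplicity (R : Type u) [CommRing R] [IsLocalRing R] [IsNoetherianRing R] (e : ℚ) : Prop :=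
  ∃ (d : ℕ) (P : Polynomial ℚ), ringKrullDim R = d ∧ IsHilbertSamuelPolynomial R P ∧
    e = (d.factorial : ℚ) * P.leadingCoeff

/-- `R` has minimal multiplicity: `e(R) = μ(𝔪) - dim R + 1`, where `μ(𝔪)` is the minimal number
of generators of the maximal ideal. -/
def HasMinimalMultiplicity (R : Type u) [CommRing R] [IsLocalRing R] [IsNoetherianRing R] : Prop :=
  ∃ d : ℕ, ringKrullDim R = d ∧
    IsMultiplicity R (((maximalIdeal R).spanFinrank : ℚ) - d + 1)

/-- An augmented minimal free resolution
`⋯ ⟶ R ^ β₂ ⟶ R ^ β₁ ⟶ R ^ β₀ ⟶ M ⟶ 0`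
of a module `M` over the local ring `R`: an exact complex whose differentials between the free
modules have image in `𝔪` times their target. -/
structure MinimalFreeResolution (R : Type u) [CommRing R] [IsLocalRing R]
    (M : Type u) [AddCommGroup M] [Module R M] where
  /-- the ranks of the free modules -/
  rank : ℕ → ℕ
  /-- the augmentation `R ^ β₀ ⟶ M` -/
  aug : (Fin (rank 0) → R) →ₗ[R] M
  /-- the differential `R ^ βₙ₊₁ ⟶ R ^ βₙ` -/
  diff : ∀ n : ℕ, (Fin (rank (n + 1)) → R) →ₗ[R] (Fin (rank n) → R)
  aug_surjective : Function.Surjective aug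
  exact_zero : Function.Exact (diff 0) aug
  exact_succ : ∀ n : ℕ, Function.Exact (diff (n + 1)) (diff n)
  minimal : ∀ n : ℕ, LinearMap.range (diff n) ≤
    maximalIdeal R • (⊤ : Submodule R (Fin (rank n) → R))

/-- The `n`-th syzygy module `Ωₙ(M)` computed from a minimal free resolution of `M`: the image of
the `n`-th map in the augmented resolution, where the `0`-th map is the augmentation (so that
`Ω₀(M)` is `M`) and the `(n + 1)`-st map is `R ^ βₙ₊₁ ⟶ R ^ βₙ`. -/
noncomputable def MinimalFreeResolution.syzygy {R : Type u} [CommRing R] [IsLocalRing R]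
    {M : Type u} [AddCommGroup M] [Module R M] (F : MinimalFreeResolution R M) :
    ℕ → ModuleCat.{u} R
  | 0 => ModuleCat.of R (LinearMap.range F.aug)
  | n + 1 => ModuleCat.of R (LinearMap.range (F.diff n))

/-- The module `M` has G-dimension zero: the natural map `M ⟶ M**` is an isomorphism, and
`Extⁱ(M, R) = 0 = Extⁱ(M*, R)` for all `i ≥ 1`, where `(-)* = Hom(-, R)`. -/
structure IsGDimZero (R : Type u) [CommRing R] (M : Type u) [AddCommGroup M] [Module R M] :
    Prop where
  bijective_eval : Function.Bijective (Module.Dual.eval R M)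
  ext_eq_zero : ∀ i : ℕ, 1 ≤ i →
    Subsingleton (Ext.{u} (ModuleCat.of R M) (ModuleCat.of R R) i)
  ext_dual_eq_zero : ∀ i : ℕ, 1 ≤ i →
    Subsingleton (Ext.{u} (ModuleCat.of R (Module.Dual R M)) (ModuleCat.of R R) i)

/-! Let `F` be the minimal free resolution of `k`. It suffices that `Extⁱ(k, R) = 0` for all `i >
d`, that is, that the dual of `F` is exact in degrees above `d`; dévissage
(`ModuleCat.subsingleton_ext_of_residueField`) then bounds the injective dimension of `R` by `d`.

Suppose first that `𝔪² = 0`. Every syzygy of `k` is killed by `𝔪`, hence so is its image `L`, a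
non-zero vector space over `k`. Thus `Ext¹(L, R) = 0` forces `Ext¹(k, R) = 0`: every linear map `𝔪 →
R` is a multiplication (`exists_eq_mul_of_exactOn_transpose`). Functionals can then be extended as
in a self-injective ring, and duals of exact minimal pairs are exact
(`exactOn_transpose_of_maximalIdeal_sq_eq_bot`).

The general case is reduced to this one modulo `d` superficial non-zero-divisors. The last quotient
has length `e(R) = μ(𝔪) - d + 1`. Its quotient by the square of the maximal ideal has at least this
length, because `λ(A/𝔪²)` starts at `μ(𝔪) + 1` and drops by at most one at each step. So the square
is zero. Since `k` may be finite, each superficial element is found after passing to the Nagata ring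
`A(X)`, as the generic combination `∑ aᵢ Xⁱ` of generators of `𝔪` (`exists_superficial_nagataRing`).

Modulo such an element `x`, the complex `F` no longer resolves `k`, but enough survives: exactness
on vectors with entries in `𝔪` (because `x ∉ 𝔪²`), exactness in high degrees, exactness of the dual
below the depth, and exactness of the dual of a resolution of `L`. The maps are therefore recorded
as matrices (`SyzygyData`), so that base change is entrywise, with these exactness properties
(`IsAdapted`) carried along. Exactness of the dual above degree `d` is lifted back through each
quotient by Nakayama, and from each Nagata ring by comparing coefficients
(`SyzygyData.IsAdapted.exactOn_transpose`). -/

set_option linter.unusedSectionVars false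

/-! ### Exactness of pairs of matrices under change of ring -/

section

open Polynomial

/-- The pair of composable matrices `M`, `N` is exact on vectors with entries in `I`: each such
vector killed by `N` lies in the image of `M`. -/
def Matrix.ExactOn {A : Type*} [CommRing A] {l m n : Type*} [Fintype l] [Fintype m] (I : Ideal A)
    (M : Matrix m l A) (N : Matrix n m A) : Prop :=
  ∀ u : m → A, (∀ j, u j ∈ I) → N.mulVec u = 0 → ∃ w, M.mulVec w = u

namespace Matrix.ExactOn

variable {A B : Type*} [CommRing A] [CommRing B]
  {k l m n : Type*} [Fintype k] [Fintype l] [Fintype m] [Fintype n]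

theorem map_mulVec_comp (φ : A →+* B) (M : Matrix m l A) (w : l → A) :
    (M.map φ).mulVec (φ ∘ w) = φ ∘ M.mulVec w := by
  ext i; simp [Matrix.mulVec, dotProduct, map_sum]

theorem exists_comp_eq {φ : A →+* B} (hφ : Function.Surjective φ) (u : m → B) :
    ∃ v : m → A, φ ∘ v = u :=
  ⟨fun j => (hφ (u j)).choose, funext fun j => (hφ (u j)).choose_spec⟩

theorem exists_eq_add_smul {φ : A →+* B} {x : A} (hker : RingHom.ker φ = Ideal.span {x})
    {u v : m → A} (h : φ ∘ u = φ ∘ v) : ∃ t : m → A, u = v + x • t := by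
  have : ∀ j, ∃ t, u j - v j = x * t := fun j => by
    have h1 : u j - v j ∈ RingHom.ker φ := by
      rw [RingHom.mem_ker, map_sub, sub_eq_zero]; exact congrFun h j
    rw [hker, Ideal.mem_span_singleton] at h1
    exact h1
  choose t ht using this
  exact ⟨t, funext fun j => by simp [← ht j]⟩

/-- Exactness passes to the quotient by a non-zero-divisor, if the next pair is exact too. -/
theorem quotient {φ : A →+* B} (hφ : Function.Surjective φ) {x : A}
    (hker : RingHom.ker φ = Ideal.span {x}) (hx : ∀ a, x * a = 0 → a = 0)
    {M : Matrix l k A} {N : Matrix m l A} {P : Matrix n m A} (hPN : P * N = 0)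
    (h₁ : ExactOn ⊤ M N) (h₂ : ExactOn ⊤ N P) : ExactOn ⊤ (M.map φ) (N.map φ) := by
  intro u _ hu
  obtain ⟨u, rfl⟩ := exists_comp_eq hφ u
  rw [map_mulVec_comp] at hu
  -- A cycle modulo `x` satisfies `N u = x v`. Regularity of `x` makes `v` a cycle for `P`, so `v =
  -- N w`, and the corrected lift `u - x w` is a cycle for `N`.
  obtain ⟨v, hv⟩ := exists_eq_add_smul (v := 0) hker (by rw [hu]; ext; simp)
  rw [zero_add] at hv
  have hPv : P.mulVec v = 0 := by
    have h0 : x • P.mulVec v = 0 := by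
      rw [← Matrix.mulVec_smul, ← hv, Matrix.mulVec_mulVec, hPN, Matrix.zero_mulVec]
    ext j; exact hx _ (congrFun h0 j)
  obtain ⟨w, hw⟩ := h₂ v (fun _ => trivial) hPv
  obtain ⟨t, ht⟩ := h₁ (u - x • w) (fun _ => trivial) (by
    rw [Matrix.mulVec_sub, Matrix.mulVec_smul, hw, hv, sub_self])
  refine ⟨φ ∘ t, ?_⟩
  rw [map_mulVec_comp, ht]
  have hx0 : φ x = 0 := by
    rw [← RingHom.mem_ker, hker]; exact Ideal.mem_span_singleton_self x
  ext j; simp [hx0]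

/-- Over a local ring, exactness modulo a non-zero-divisor in the maximal ideal implies
exactness. -/
theorem of_quotient [IsLocalRing A] [IsNoetherianRing A] {φ : A →+* B}
    (hφ : Function.Surjective φ) {x : A} (hxm : x ∈ maximalIdeal A)
    (hker : RingHom.ker φ = Ideal.span {x}) (hx : ∀ a, x * a = 0 → a = 0)
    {M : Matrix l k A} {N : Matrix m l A} (hNM : N * M = 0)
    (h : ExactOn ⊤ (M.map φ) (N.map φ)) : ExactOn ⊤ M N := by
  have key : LinearMap.ker N.mulVecLin ≤ LinearMap.range M.mulVecLin := by
    -- Nakayama: a cycle is `M w + x t` with `t` again a cycle, so `ker N ≤ im M + 𝔪 ker N`.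
    refine Submodule.le_of_le_smul_of_le_jacobson_bot (I := maximalIdeal A)
      (IsNoetherian.noetherian _) (IsLocalRing.maximalIdeal_le_jacobson _) ?_
    intro u hu
    rw [LinearMap.mem_ker, Matrix.mulVecLin_apply] at hu
    obtain ⟨w, hw⟩ := h (φ ∘ u) (fun _ => trivial) (by rw [map_mulVec_comp, hu]; ext; simp)
    obtain ⟨w, rfl⟩ := exists_comp_eq hφ w
    rw [map_mulVec_comp] at hw
    obtain ⟨t, ht⟩ := exists_eq_add_smul hker hw.symm
    have hNt : N.mulVec t = 0 := by
      have h0 : x • N.mulVec t = 0 := by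
        have : N.mulVec (M.mulVec w) = 0 := by rw [Matrix.mulVec_mulVec, hNM, Matrix.zero_mulVec]
        rw [ht, Matrix.mulVec_add, this, zero_add, Matrix.mulVec_smul] at hu
        exact hu
      ext j; exact hx _ (congrFun h0 j)
    rw [ht]
    exact Submodule.add_mem_sup ⟨w, rfl⟩ (Submodule.smul_mem_smul hxm hNt)
  intro u _ hu
  exact key (show u ∈ LinearMap.ker N.mulVecLin from hu)

/-- Exactness on the vectors with entries in the maximal ideal passes to the quotient of a minimal
complex by a non-zero-divisor outside the square of the maximal ideal. -/
theorem quotient_maximalIdeal [IsLocalRing A] [IsLocalRing B] {φ : A →+* B}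
    (hφ : Function.Surjective φ) {x : A} (hxm : x ∈ maximalIdeal A)
    (hxm2 : x ∉ maximalIdeal A ^ 2)
    (hker : RingHom.ker φ = Ideal.span {x}) (hx : ∀ a, x * a = 0 → a = 0)
    {M : Matrix l k A} {N : Matrix m l A} {P : Matrix n m A} (hPN : P * N = 0)
    (hN : ∀ i j, N i j ∈ maximalIdeal A)
    (h₁ : ExactOn (maximalIdeal A) M N) (h₂ : ExactOn (maximalIdeal A) N P) :
    ExactOn (maximalIdeal B) (M.map φ) (N.map φ) := by
  intro u hum hu
  obtain ⟨u, rfl⟩ := exists_comp_eq hφ u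
  have hum' : ∀ j, u j ∈ maximalIdeal A := fun j => by
    by_contra hj
    have : IsUnit (u j) := by simpa using hj
    exact (hum j) (this.map φ)
  rw [map_mulVec_comp] at hu
  obtain ⟨v, hv⟩ := exists_eq_add_smul (v := 0) hker (by rw [hu]; ext; simp)
  rw [zero_add] at hv
  have hPv : P.mulVec v = 0 := by
    have h0 : x • P.mulVec v = 0 := by
      rw [← Matrix.mulVec_smul, ← hv, Matrix.mulVec_mulVec, hPN, Matrix.zero_mulVec]
    ext j; exact hx _ (congrFun h0 j)
  -- `N u = x v` has entries in `𝔪²`, since `N` and `u` have entries in `𝔪`; a unit entry of `v`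
  -- would put `x` into `𝔪²`.
  have hvm : ∀ j, v j ∈ maximalIdeal A := fun j => by
    by_contra hj
    have hju : IsUnit (v j) := by simpa using hj
    apply hxm2
    have h2 : x * v j ∈ maximalIdeal A ^ 2 := by
      have : N.mulVec u j = x * v j := congrFun hv j
      rw [← this, pow_two]
      exact Ideal.sum_mem _ fun i _ => Ideal.mul_mem_mul (hN j i) (hum' i)
    exact (Ideal.mul_unit_mem_iff_mem _ hju).mp h2
  obtain ⟨w, hw⟩ := h₂ v hvm hPv
  obtain ⟨t, ht⟩ := h₁ (u - x • w)
    (fun j => Ideal.sub_mem _ (hum' j) (Ideal.mul_mem_right _ _ hxm)) (by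
    rw [Matrix.mulVec_sub, Matrix.mulVec_smul, hw, hv, sub_self])
  refine ⟨φ ∘ t, ?_⟩
  rw [map_mulVec_comp, ht]
  have hx0 : φ x = 0 := by
    rw [← RingHom.mem_ker, hker]; exact Ideal.mem_span_singleton_self x
  ext j; simp [hx0]


theorem exists_mulVec_eq_of_coeff {M : Matrix m l A} {Q : m → A[X]}
    (h : ∀ i, ∃ w, M.mulVec w = fun j => (Q j).coeff i) :
    ∃ W, (M.map C).mulVec W = Q := by
  classical
  choose w hw using h
  obtain ⟨D, hD⟩ : ∃ D, ∀ j, (Q j).natDegree < D :=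
    ⟨(Finset.univ.sup fun j => (Q j).natDegree) + 1, fun j =>
      Nat.lt_succ_of_le (Finset.le_sup (f := fun j => (Q j).natDegree) (Finset.mem_univ j))⟩
  refine ⟨fun i => ∑ e ∈ Finset.range D, monomial e (w e i), ?_⟩
  ext j e
  have h1 : ((M.map C).mulVec (fun i => ∑ e ∈ Finset.range D, monomial e (w e i)) j) =
      ∑ e ∈ Finset.range D, monomial e ((Q j).coeff e) := by
    simp only [Matrix.mulVec, dotProduct, Matrix.map_apply, Finset.mul_sum, C_mul_monomial]
    rw [Finset.sum_comm]
    refine Finset.sum_congr rfl fun e _ => ?_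
    rw [← congrFun (hw e) j, Matrix.mulVec, dotProduct, map_sum]
  rw [h1, ← (Q j).as_sum_range' D (hD j)]

/-- Exactness is preserved by passing to the polynomial ring. -/
theorem map_C {I : Ideal A} {M : Matrix m l A} {N : Matrix n m A} (h : ExactOn I M N) :
    ExactOn (I.map (C : A →+* A[X])) (M.map C) (N.map C) := by
  intro u hu hNu
  refine exists_mulVec_eq_of_coeff fun i => h _ (fun j => Ideal.mem_map_C_iff.mp (hu j) i) ?_
  ext a
  have := congrArg (fun p : A[X] => p.coeff i) (congrFun hNu a)
  simpa [Matrix.mulVec, dotProduct, Polynomial.finsetSum_coeff] using this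

/-- Exactness is preserved by localization. -/
theorem map_localization (S : Submonoid A) [Algebra A B] [IsLocalization S B] {I : Ideal A}
    {M : Matrix m l A} {N : Matrix n m A} (h : ExactOn I M N) :
    ExactOn (I.map (algebraMap A B)) (M.map (algebraMap A B)) (N.map (algebraMap A B)) := by
  classical
  intro u hu hNu
  have h1 : ∃ (s : S) (p : m → A), (∀ j, p j ∈ I) ∧
      ∀ j, algebraMap A B s * u j = algebraMap A B (p j) := by
    have : ∀ j, ∃ (p : I) (s : S), u j * algebraMap A B s = algebraMap A B p := fun j => by
      obtain ⟨⟨p, s⟩, h⟩ := (IsLocalization.mem_map_algebraMap_iff S B).mp (hu j)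
      exact ⟨p, s, h⟩
    choose p s hps using this
    refine ⟨∏ j, s j, fun j => (∏ i ∈ Finset.univ.erase j, s i : S) * (p j : A),
      fun j => Ideal.mul_mem_left _ _ (p j).2, fun j => ?_⟩
    rw [← Finset.prod_erase_mul _ _ (Finset.mem_univ j), Submonoid.coe_mul, map_mul, map_mul,
      ← hps j]
    ring
  obtain ⟨s, p, hp, hsp⟩ := h1
  have h2 : ∃ t : S, ∀ i, (t : A) * N.mulVec p i = 0 := by
    have : ∀ i, ∃ t : S, (t : A) * N.mulVec p i = 0 := fun i => by
      have h0 : algebraMap A B (N.mulVec p i) = 0 := by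
        have e : (algebraMap A B) ∘ p = algebraMap A B s • u := funext fun j => (hsp j).symm
        have := congrFun (map_mulVec_comp (algebraMap A B) N p) i
        rw [e, Matrix.mulVec_smul, hNu] at this
        simpa using this.symm
      obtain ⟨t, ht⟩ := (IsLocalization.map_eq_zero_iff S B _).mp h0
      exact ⟨t, ht⟩
    choose t ht using this
    refine ⟨∏ i, t i, fun i => ?_⟩
    rw [← Finset.prod_erase_mul _ _ (Finset.mem_univ i), Submonoid.coe_mul, mul_assoc, ht i,
      mul_zero]
  obtain ⟨t, ht⟩ := h2
  obtain ⟨w, hw⟩ := h (fun j => t * p j) (fun j => Ideal.mul_mem_left _ _ (hp j)) (by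
    ext i
    have := Matrix.mulVec_smul N (t : A) p
    exact (congrFun this i).trans (ht i))
  have hu1 := IsLocalization.map_units B (t * s)
  refine ⟨(↑hu1.unit⁻¹ : B) • (algebraMap A B ∘ w), ?_⟩
  rw [Matrix.mulVec_smul, map_mulVec_comp, hw]
  ext j
  have : (algebraMap A B) (↑t * p j) = hu1.unit * u j := by
    simp [map_mul, ← hsp j, mul_assoc]
  simp only [Pi.smul_apply, Function.comp_apply, smul_eq_mul, this, Units.inv_mul_cancel_left]

end Matrix.ExactOn

/-! ### Annihilation by powers of the coefficients of a polynomial -/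

/-- Compare coefficients of degree `e` in `q₀ ^ e * (q * z) = 0`: every term except `q₀ * zₑ`
involves a lower coefficient of `z`, which `q₀ ^ e` kills by induction. -/
theorem Polynomial.coeff_zero_pow_mul_coeff_eq_zero {D : Type*} [CommRing D] {q z : D[X]}
    (h : q * z = 0) (e : ℕ) : q.coeff 0 ^ (e + 1) * z.coeff e = 0 := by
  induction e using Nat.strong_induction_on with
  | _ e ih =>
    have h1 : q.coeff 0 ^ e * (q * z).coeff e = 0 := by rw [h]; simp
    rw [coeff_mul, Finset.mul_sum, Finset.sum_eq_single_of_mem (0, e) (by simp)] at h1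
    · rw [pow_succ, mul_assoc]; exact h1
    · rintro ⟨a, b⟩ hab hne
      rw [Finset.HasAntidiagonal.mem_antidiagonal] at hab
      have hb : b < e := by
        rcases Nat.eq_zero_or_pos a with rfl | ha
        · exact absurd (by simpa using hab) (fun hbe : b = e => hne (by rw [hbe]))
        · simp only at hab; omega
      obtain ⟨c, rfl⟩ : ∃ c, e = b + 1 + c := ⟨e - (b + 1), by omega⟩
      calc q.coeff 0 ^ (b + 1 + c) * (q.coeff a * z.coeff b)
          = q.coeff 0 ^ c * q.coeff a * (q.coeff 0 ^ (b + 1) * z.coeff b) := by ring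
        _ = 0 := by rw [ih b hb, mul_zero]

/-- If a power of a polynomial `p` kills `z`, then so does a power of each coefficient of `p`. -/
theorem Polynomial.exists_C_coeff_pow_mul_eq_zero {D : Type*} [CommRing D] {p z : D[X]} {N : ℕ}
    (h : p ^ N * z = 0) (i : ℕ) : ∃ M, C (p.coeff i) ^ M * z = 0 := by
  have base : ∀ (p : D[X]) (N : ℕ), p ^ N * z = 0 → ∃ M, C (p.coeff 0) ^ M * z = 0 := by
    intro p N h
    -- An exponent that serves all coefficients of `z` at once: the previous lemma is applied to `p
    -- ^ N`, whose constant coefficient is that of `p` to the power `N`.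
    refine ⟨N * (z.natDegree + 1), ?_⟩
    ext e
    rw [← C_pow, coeff_C_mul, coeff_zero]
    rcases le_or_gt e z.natDegree with he | he
    · have h1 := coeff_zero_pow_mul_coeff_eq_zero h e
      have h2 : (p ^ N).coeff 0 = p.coeff 0 ^ N := by simp [coeff_zero_eq_eval_zero]
      rw [h2, ← pow_mul] at h1
      obtain ⟨c, hc⟩ := Nat.exists_eq_add_of_le (Nat.mul_le_mul_left N (Nat.succ_le_succ he))
      rw [hc, pow_add, mul_right_comm, h1, zero_mul]
    · rw [coeff_eq_zero_of_natDegree_lt he, mul_zero]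
  induction i generalizing p N with
  | zero => exact base p N h
  | succ i ih =>
    obtain ⟨M, hM⟩ := base p N h
    let K : Ideal D[X] := LinearMap.ker (LinearMap.toSpanSingleton D[X] D[X] z)
    have hK : ∀ f, f ∈ K ↔ f * z = 0 := fun f => by
      simp [K, LinearMap.mem_ker, LinearMap.toSpanSingleton_apply]
    -- The radical of the annihilator of `z` contains `p` and its constant coefficient, hence their
    -- difference; `X` can then be cancelled.
    have h1 : p.divX * X ∈ K.radical := by
      have : p.divX * X = p - C (p.coeff 0) := by
        rw [eq_sub_iff_add_eq, divX_mul_X_add]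
      rw [this]
      exact sub_mem ⟨N, (hK _).2 h⟩ ⟨M, (hK _).2 hM⟩
    obtain ⟨L, hL⟩ := h1
    rw [hK, mul_pow, mul_comm (p.divX ^ L), mul_assoc] at hL
    have h2 : p.divX ^ L * z = 0 := by
      ext e
      have := congrArg (fun f => coeff f (e + L)) hL
      simpa [coeff_X_pow_mul] using this
    simpa using ih h2

/-! ### The Rees algebra and torsion in the associated graded ring -/

namespace IsLocalRing

variable {A : Type*} [CommRing A]

/-- The ideal of the Rees algebra of `I` whose quotient is the associated graded ring. -/
def reesShift (I : Ideal A) : Ideal (reesAlgebra I) where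
  carrier := {f | ∀ n, (f : A[X]).coeff n ∈ I ^ (n + 1)}
  add_mem' ha hb n := by simpa using add_mem (ha n) (hb n)
  zero_mem' n := by simp
  smul_mem' c f hf n := by
    simp only [smul_eq_mul, MulMemClass.coe_mul, coeff_mul]
    refine Ideal.sum_mem _ ?_
    rintro ⟨a, b⟩ hab
    rw [Finset.HasAntidiagonal.mem_antidiagonal] at hab
    simp only at hab
    rw [← hab, add_assoc, pow_add]
    exact Ideal.mul_mem_mul (c.2 a) (hf b)

/-- The homogeneous element of degree `n` of the Rees algebra given by `a ∈ I ^ n`. -/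
noncomputable def reesMonomial {I : Ideal A} (n : ℕ) {a : A} (h : a ∈ I ^ n) : reesAlgebra I :=
  ⟨monomial n a, reesAlgebra.monomial_mem.2 h⟩

theorem reesMonomial_mem_reesShift {I : Ideal A} {n : ℕ} {a : A} (h : a ∈ I ^ n) :
    reesMonomial n h ∈ reesShift I ↔ a ∈ I ^ (n + 1) := by
  constructor
  · intro h1
    simpa [reesMonomial] using h1 n
  · intro h1 k
    simp only [reesMonomial, coeff_monomial]
    split_ifs with hk
    · rw [← hk]; exact h1
    · exact zero_mem _

theorem reesMonomial_mul {I : Ideal A} {m n : ℕ} {a b : A} (ha : a ∈ I ^ m) (hb : b ∈ I ^ n) :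
    reesMonomial m ha * reesMonomial n hb =
      reesMonomial (m + n) (by rw [pow_add]; exact Ideal.mul_mem_mul ha hb : a * b ∈ I ^ (m + n)) :=
  Subtype.ext (monomial_mul_monomial _ _ _ _)

theorem reesMonomial_pow {I : Ideal A} {a : A} (ha : a ∈ I ^ 1) (N : ℕ) :
    reesMonomial 1 ha ^ N =
      reesMonomial N (Ideal.pow_mem_pow (by simpa using ha) N : a ^ N ∈ I ^ N) :=
  Subtype.ext (by simp [reesMonomial, monomial_pow])

variable {ι : Type*}

/-- Elements of degree at least `M` lie in the `M`-th power of the irrelevant ideal. -/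
theorem mem_pow_span_reesMonomial {I : Ideal A} {a : ι → A} (ha : ∀ i, a i ∈ I ^ 1)
    (hI : Ideal.span (Set.range a) = I) (M : ℕ) (f : reesAlgebra I)
    (hf : ∀ n < M, (f : A[X]).coeff n = 0) :
    f ∈ Ideal.span (Set.range fun i => reesMonomial 1 (ha i)) ^ M := by
  have h1 : ∀ (n : ℕ) (b : A) (hb : b ∈ I ^ n), reesMonomial n hb ∈
      Ideal.span (Set.range fun i => reesMonomial 1 (ha i)) ^ n := by
    intro n
    induction n with
    | zero => intro b hb; simp
    | succ n ih =>
      intro b hb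
      have hb' : b ∈ I ^ n * I := by rwa [← pow_succ]
      have : ∃ hc, reesMonomial (a := b) (n + 1) hc ∈
          Ideal.span (Set.range fun i => reesMonomial 1 (ha i)) ^ (n + 1) := by
        refine Submodule.mul_induction_on (C := fun b => ∃ hc, reesMonomial (a := b) (n + 1) hc ∈
          Ideal.span (Set.range fun i => reesMonomial 1 (ha i)) ^ (n + 1)) hb' ?_ ?_
        · intro x hx y hy
          have hy1 : y ∈ I ^ 1 := by simpa using hy
          have hlin : reesMonomial 1 hy1 ∈ Ideal.span (Set.range fun i => reesMonomial 1 (ha i)) := by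
            rw [← hI] at hy
            have : ∃ hc, reesMonomial (a := y) (I := I) 1 hc ∈
                Ideal.span (Set.range fun i => reesMonomial 1 (ha i)) := by
              refine Submodule.span_induction (p := fun y _ => ∃ hc,
                reesMonomial (a := y) (I := I) 1 hc ∈
                Ideal.span (Set.range fun i => reesMonomial 1 (ha i))) ?_ ?_ ?_ ?_ hy
              · rintro _ ⟨i, rfl⟩
                exact ⟨ha i, Ideal.subset_span ⟨i, rfl⟩⟩
              · refine ⟨zero_mem _, ?_⟩
                have : reesMonomial (I := I) (a := 0) 1 (zero_mem _) = 0 :=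
                  Subtype.ext (by simp [reesMonomial])
                rw [this]
                exact zero_mem _
              · rintro y z _ _ ⟨hy, hy'⟩ ⟨hz, hz'⟩
                refine ⟨add_mem hy hz, ?_⟩
                convert! add_mem hy' hz'
                exact Subtype.ext (by simp [reesMonomial])
              · rintro c y _ ⟨hy, hy'⟩
                refine ⟨Ideal.mul_mem_left _ _ hy, ?_⟩
                convert! Ideal.mul_mem_left _ (algebraMap A (reesAlgebra I) c) hy'
                exact Subtype.ext (by simp [reesMonomial, C_mul_monomial])
            exact this.choose_spec
          refine ⟨by rw [pow_succ]; exact Ideal.mul_mem_mul hx hy, ?_⟩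
          have := Ideal.mul_mem_mul (ih x hx) hlin
          rw [reesMonomial_mul, ← pow_succ] at this
          exact this
        · rintro x y ⟨hx, hx'⟩ ⟨hy, hy'⟩
          refine ⟨add_mem hx hy, ?_⟩
          convert! add_mem hx' hy'
          exact Subtype.ext (by simp [reesMonomial])
      exact this.choose_spec
  have h2 : f = ∑ n ∈ (f : A[X]).support, reesMonomial n (f.2 n) := by
    refine Subtype.ext ?_
    rw [AddSubmonoidClass.coe_finsetSum]
    exact (f : A[X]).as_sum_support
  rw [h2]
  refine Ideal.sum_mem _ fun n hn => ?_
  have : M ≤ n := by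
    by_contra hlt
    exact (mem_support_iff.mp hn) (hf n (not_le.mp hlt))
  exact Ideal.pow_le_pow_right this (h1 n _ _)

/-- In large degrees, the associated graded ring of an ideal has no non-zero elements killed by a
power of the irrelevant ideal. -/
theorem exists_forall_mem_pow_succ [IsNoetherianRing A] {I : Ideal A} {a : ι → A}
    (hI : Ideal.span (Set.range a) = I) :
    ∃ c, ∀ j ≥ c, ∀ w ∈ I ^ j, (∀ i, ∃ N, a i ^ N * w ∈ I ^ (j + N + 1)) → w ∈ I ^ (j + 1) := by
  have ha : ∀ i, a i ∈ I ^ 1 := fun i => by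
    rw [pow_one, ← hI]; exact Ideal.subset_span ⟨i, rfl⟩
  set α : ι → reesAlgebra I := fun i => reesMonomial 1 (ha i) with hα
  set J := reesShift I
  -- Modulo `J` this is the torsion of the associated graded ring with respect to the irrelevant
  -- ideal. It is finitely generated, so one power `M` of that ideal carries all generators into
  -- `J`.
  let H : Ideal (reesAlgebra I) :=
    { carrier := {f | ∀ i, ∃ N, α i ^ N * f ∈ J}
      add_mem' := fun {f g} hf hg i => by
        obtain ⟨N, hN⟩ := hf i
        obtain ⟨M, hM⟩ := hg i
        refine ⟨N + M, ?_⟩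
        have : α i ^ (N + M) * (f + g) =
          α i ^ M * (α i ^ N * f) + α i ^ N * (α i ^ M * g) := by ring
        rw [this]
        exact add_mem (Ideal.mul_mem_left _ _ hN) (Ideal.mul_mem_left _ _ hM)
      zero_mem' := fun i => ⟨0, by simp⟩
      smul_mem' := fun c f hf i => by
        obtain ⟨N, hN⟩ := hf i
        refine ⟨N, ?_⟩
        have : α i ^ N * (c • f) = c * (α i ^ N * f) := by rw [smul_eq_mul]; ring
        rw [this]
        exact Ideal.mul_mem_left _ _ hN }
  obtain ⟨S, hS⟩ := (IsNoetherian.noetherian H : H.FG)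
  have hSM : ∀ f ∈ H, ∃ M, ∀ g ∈ Ideal.span (Set.range α) ^ M, g * f ∈ J := by
    intro f hf
    let K : Ideal (reesAlgebra I) := Submodule.comap (LinearMap.toSpanSingleton _ (reesAlgebra I) f) J
    have hle : Ideal.span (Set.range α) ≤ K.radical := by
      rw [Ideal.span_le]
      rintro _ ⟨i, rfl⟩
      obtain ⟨N, hN⟩ := hf i
      exact ⟨N, hN⟩
    obtain ⟨M, hM⟩ := Ideal.exists_pow_le_of_le_radical_of_fg hle (IsNoetherian.noetherian _)
    exact ⟨M, fun g hg => hM hg⟩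
  have hMS : ∃ M, ∀ f ∈ S, ∀ g ∈ Ideal.span (Set.range α) ^ M, g * f ∈ J := by
    have hS' : ∀ f : S, (f : reesAlgebra I) ∈ H := fun f => by
      rw [← hS]; exact Ideal.subset_span f.2
    choose M hM using fun f : S => hSM f (hS' f)
    refine ⟨Finset.univ.sup M, fun f hf g hg => hM ⟨f, hf⟩ g ?_⟩
    exact Ideal.pow_le_pow_right (Finset.le_sup (f := M) (Finset.mem_univ _)) hg
  obtain ⟨M, hM⟩ := hMS
  let c₀ := S.sup fun f => (f : A[X]).natDegree
  -- The generators have degree at most `c₀`. In degree `j ≥ M + c₀` only the parts of the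
  -- coefficients in degrees at least `M` contribute, and these lie in the `M`-th power of the
  -- irrelevant ideal.
  refine ⟨M + c₀, fun j hj w hw hwa => ?_⟩
  have hwH : reesMonomial j hw ∈ H := by
    intro i
    obtain ⟨N, hN⟩ := hwa i
    refine ⟨N, ?_⟩
    rw [hα]
    simp only
    rw [reesMonomial_pow, reesMonomial_mul, reesMonomial_mem_reesShift, Nat.add_comm N j]
    exact hN
  rw [← hS] at hwH
  obtain ⟨r, hr⟩ := Submodule.mem_span_finset'.mp hwH
  have hlow : ∀ r : reesAlgebra I, ∃ s : reesAlgebra I, 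
      r - s ∈ Ideal.span (Set.range α) ^ M ∧ ∀ n ≥ M, (s : A[X]).coeff n = 0 := by
    intro r
    have hs : (∑ n ∈ Finset.range M, monomial n ((r : A[X]).coeff n)) ∈ reesAlgebra I :=
      Subalgebra.sum_mem _ fun n _ => reesAlgebra.monomial_mem.2 (r.2 n)
    have hco : ∀ n, (∑ n ∈ Finset.range M, monomial n ((r : A[X]).coeff n) : A[X]).coeff n =
        if n < M then (r : A[X]).coeff n else 0 := fun n => by
      simp [Polynomial.finsetSum_coeff, coeff_monomial]
    have h0 : ∀ n ≥ M, (∑ n ∈ Finset.range M, monomial n ((r : A[X]).coeff n) : A[X]).coeff n = 0 :=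
      fun n hn => by rw [hco, if_neg (not_lt.mpr hn)]
    refine ⟨⟨_, hs⟩, ?_, h0⟩
    refine mem_pow_span_reesMonomial ha hI M _ fun n hn => ?_
    simp [hco, hn]
  choose s hs1 hs2 using fun f : S => hlow (r f)
  have hdiff : reesMonomial j hw - ∑ f : S, s f * (f : reesAlgebra I) ∈ J := by
    rw [← hr, ← Finset.sum_sub_distrib]
    refine Ideal.sum_mem _ fun f _ => ?_
    rw [smul_eq_mul, ← sub_mul]
    exact hM f f.2 _ (hs1 f)
  have hco := hdiff j
  have hzero : ((∑ f : S, s f * (f : reesAlgebra I) : reesAlgebra I) : A[X]).coeff j = 0 := by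
    rw [AddSubmonoidClass.coe_finsetSum, Polynomial.finsetSum_coeff]
    refine Finset.sum_eq_zero fun f _ => ?_
    rw [MulMemClass.coe_mul, coeff_mul]
    refine Finset.sum_eq_zero ?_
    rintro ⟨p, q⟩ hpq
    rw [Finset.HasAntidiagonal.mem_antidiagonal] at hpq
    simp only at hpq ⊢
    by_cases hp : M ≤ p
    · rw [hs2 f p hp, zero_mul]
    · have hq : c₀ < q := by omega
      have : ((f : reesAlgebra I) : A[X]).natDegree ≤ c₀ :=
        Finset.le_sup (f := fun f : reesAlgebra I => (f : A[X]).natDegree) f.2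
      rw [coeff_eq_zero_of_natDegree_lt (lt_of_le_of_lt this hq), mul_zero]
  rw [AddSubgroupClass.coe_sub, coeff_sub, hzero, sub_zero] at hco
  simpa [reesMonomial] using hco

end IsLocalRing

/-! ### Generic linear forms and superficial elements -/

namespace IsLocalRing

variable {A : Type*} [CommRing A]

theorem exists_polynomial_reesAlgebra {I : Ideal A} {n : ℕ} {q : A[X]}
    (hq : ∀ e, q.coeff e ∈ I ^ n) :
    ∃ Q : (reesAlgebra I)[X], ∀ e, Q.coeff e = reesMonomial n (hq e) := by
  refine ⟨∑ e ∈ Finset.range (q.natDegree + 1), monomial e (reesMonomial n (hq e)), fun e => ?_⟩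
  rw [Polynomial.finsetSum_coeff]
  simp only [coeff_monomial, Finset.sum_ite_eq', Finset.mem_range]
  split_ifs with h
  · rfl
  · refine Subtype.ext ?_
    have : q.coeff e = 0 := coeff_eq_zero_of_natDegree_lt (by omega)
    simp [reesMonomial, this]

/-- A polynomial whose coefficients generate the ideal `I` acts injectively on the associated graded
ring of `I` in large degrees. -/
theorem mem_map_C_pow_succ_of_mul_mem {I : Ideal A} {ι : Type*} {a : ι → A} {p : A[X]}
    (hp : ∀ e, p.coeff e ∈ I ^ 1) (hap : ∀ i, ∃ e, p.coeff e = a i) {j : ℕ}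
    (hj : ∀ w ∈ I ^ j, (∀ i, ∃ N, a i ^ N * w ∈ I ^ (j + N + 1)) → w ∈ I ^ (j + 1))
    {z : A[X]} (hz : ∀ e, z.coeff e ∈ I ^ j) (hpz : ∀ e, (p * z).coeff e ∈ I ^ (j + 2)) (e : ℕ) :
    z.coeff e ∈ I ^ (j + 1) := by
  obtain ⟨P, hP⟩ := exists_polynomial_reesAlgebra hp
  obtain ⟨Z, hZ⟩ := exists_polynomial_reesAlgebra hz
  -- `D` is the associated graded ring. Over it the forms of `p`, of degree one, and of `z`, of
  -- degree `j`, have product zero, so powers of the form of each `a i` kill that of `z`.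
  obtain ⟨D, _, π, hπ⟩ : ∃ (D : Type _) (_ : CommRing D) (π : reesAlgebra I →+* D),
      ∀ f, π f = 0 ↔ f ∈ reesShift I :=
    ⟨reesAlgebra I ⧸ reesShift I, inferInstance, Ideal.Quotient.mk _,
      fun f => Ideal.Quotient.eq_zero_iff_mem⟩
  have hPZ : P.map π ^ 1 * Z.map π = 0 := by
    rw [pow_one, ← Polynomial.map_mul]
    ext n
    rw [coeff_map, coeff_zero, hπ]
    have h1 : (((P * Z).coeff n : reesAlgebra I) : A[X]) = monomial (j + 1) ((p * z).coeff n) := by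
      rw [coeff_mul, coeff_mul, AddSubmonoidClass.coe_finsetSum, map_sum]
      refine Finset.sum_congr rfl fun x _ => ?_
      rw [MulMemClass.coe_mul, hP, hZ]
      simp [reesMonomial, monomial_mul_monomial, Nat.add_comm]
    refine fun k => ?_
    rw [h1, coeff_monomial]
    split_ifs with hk
    · rw [← hk]; exact hpz n
    · exact zero_mem _
  refine hj _ (hz e) fun i => ?_
  obtain ⟨d, hd⟩ := hap i
  obtain ⟨M, hM⟩ := exists_C_coeff_pow_mul_eq_zero hPZ d
  refine ⟨M, ?_⟩
  have h2 := congrArg (fun f => coeff f e) hM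
  rw [← C_pow] at h2
  simp only [coeff_C_mul, coeff_map, coeff_zero] at h2
  rw [← map_pow, ← map_mul, hπ, hP, hZ, reesMonomial_pow,
    reesMonomial_mul, reesMonomial_mem_reesShift, hd] at h2
  rw [Nat.add_comm j M]
  exact h2

/-- Artin-Rees places `z` in `I ^ c`, beyond which the associated graded ring has no torsion; from
there `z` climbs one power of `I` at a time. -/
theorem exists_forall_mem_map_C_pow [IsNoetherianRing A] {I : Ideal A} {ι : Type*} {a : ι → A}
    (hI : Ideal.span (Set.range a) = I) {p : A[X]}
    (hp : ∀ e, p.coeff e ∈ I ^ 1) (hap : ∀ i, ∃ e, p.coeff e = a i) (hreg : ∀ z, p * z = 0 → z = 0) :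
    ∃ n₀, ∀ n ≥ n₀, ∀ z, p * z ∈ (I ^ (n + 1)).map (C : A →+* A[X]) →
      z ∈ (I ^ n).map (C : A →+* A[X]) := by
  obtain ⟨c, hc⟩ := exists_forall_mem_pow_succ hI
  obtain ⟨k, hk⟩ := Ideal.exists_pow_inf_eq_pow_smul (I.map (C : A →+* A[X]))
    (Ideal.span {p} : Submodule A[X] A[X])
  refine ⟨c + k, fun n hn z hz => ?_⟩
  have h0 : z ∈ (I ^ c).map (C : A →+* A[X]) := by
    have h1 : p * z ∈ (I.map (C : A →+* A[X])) ^ (n + 1) • (⊤ : Submodule A[X] A[X]) ⊓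
        (Ideal.span {p} : Submodule A[X] A[X]) := by
      refine ⟨?_, Ideal.mul_mem_right _ _ (Ideal.mem_span_singleton_self p)⟩
      rw [smul_eq_mul, Ideal.mul_top, ← Ideal.map_pow]
      exact hz
    rw [hk (n + 1) (by omega)] at h1
    have h2 : p * z ∈ (I.map (C : A →+* A[X])) ^ (n + 1 - k) * Ideal.span {p} :=
      Submodule.smul_mono le_rfl inf_le_right h1
    rw [Ideal.mem_mul_span_singleton] at h2
    obtain ⟨y, hy, hyp⟩ := h2
    have : z = y := by
      rw [← sub_eq_zero]
      apply hreg
      rw [mul_sub, ← hyp]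
      ring
    rw [this, Ideal.map_pow]
    exact Ideal.pow_le_pow_right (by omega) hy
  have key : ∀ j, c ≤ j → j ≤ n → z ∈ (I ^ j).map (C : A →+* A[X]) := by
    intro j hcj
    induction j, hcj using Nat.le_induction with
    | base => exact fun _ => h0
    | succ j hcj ih =>
      intro hjn
      have h1 := ih (by omega)
      rw [Ideal.mem_map_C_iff] at h1 hz ⊢
      exact mem_map_C_pow_succ_of_mul_mem hp hap (hc j hcj) h1
        (fun e => Ideal.pow_le_pow_right (by omega) (hz e))
  exact key n (by omega) le_rfl

/-! ### The Nagata ring and its superficial elements -/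

section Nagata

variable (A) [IsLocalRing A]

instance : ((maximalIdeal A).map (C : A →+* A[X])).IsPrime :=
  Ideal.isPrime_map_C_of_isPrime

/-- The Nagata ring `A(X)` of a local ring `A`: the localization of `A[X]` at `𝔪 A[X]`. -/
abbrev NagataRing := Localization.AtPrime ((maximalIdeal A).map (C : A →+* A[X]))

variable {A}

theorem mem_primeCompl_map_C_iff {f : A[X]} :
    f ∈ ((maximalIdeal A).map (C : A →+* A[X])).primeCompl ↔ ∃ i, IsUnit (f.coeff i) := by
  rw [Ideal.mem_primeCompl_iff, Ideal.mem_map_C_iff]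
  simp

theorem algebraMap_nagataRing :
    algebraMap A (NagataRing A) = (algebraMap A[X] (NagataRing A)).comp C := by
  rw [IsScalarTower.algebraMap_eq A A[X] (NagataRing A)]; rfl

theorem map_algebraMap_nagataRing (I : Ideal A) :
    I.map (algebraMap A (NagataRing A)) =
      (I.map (C : A →+* A[X])).map (algebraMap A[X] (NagataRing A)) := by
  rw [Ideal.map_map, algebraMap_nagataRing]

theorem maximalIdeal_nagataRing :
    maximalIdeal (NagataRing A) = (maximalIdeal A).map (algebraMap A (NagataRing A)) := by
  rw [map_algebraMap_nagataRing, Localization.AtPrime.map_eq_maximalIdeal]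

theorem ringKrullDim_nagataRing [IsNoetherianRing A] :
    ringKrullDim (NagataRing A) = ringKrullDim A := by
  rw [IsLocalization.AtPrime.ringKrullDim_eq_height ((maximalIdeal A).map (C : A →+* A[X])),
    Polynomial.height_map_C, maximalIdeal_height_eq_ringKrullDim]

/-- If the maximal ideal of `A` kills no non-zero element, then the Nagata ring of `A` has a
non-zero-divisor `x` in its maximal ideal such that `(𝔪 ^ (n + 1) : x) = 𝔪 ^ n` for all `n ≫ 0`. -/
theorem exists_superficial_nagataRing [IsNoetherianRing A]
    (h : ∀ b : A, (∀ y ∈ maximalIdeal A, b * y = 0) → b = 0) :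
    ∃ x ∈ maximalIdeal (NagataRing A), (∀ z, x * z = 0 → z = 0) ∧
      ∃ n₀, ∀ n ≥ n₀, ∀ z, x * z ∈ maximalIdeal (NagataRing A) ^ (n + 1) →
        z ∈ maximalIdeal (NagataRing A) ^ n := by
  obtain ⟨e, a, ha⟩ := Submodule.fg_iff_exists_fin_generating_family.mp
    (IsNoetherian.noetherian (maximalIdeal A))
  -- The powers of the variable serve as generic coefficients, so the residue field may be finite.
  let p : A[X] := ∑ i : Fin e, monomial i (a i)
  have hpc : ∀ n, p.coeff n = if h : n < e then a ⟨n, h⟩ else 0 := by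
    intro n
    simp only [p, Polynomial.finsetSum_coeff, coeff_monomial]
    split_ifs with hn
    · rw [Finset.sum_eq_single_of_mem ⟨n, hn⟩ (Finset.mem_univ _)]
      · simp
      · intro b _ hb
        rw [if_neg]
        rintro rfl
        exact hb rfl
    · refine Finset.sum_eq_zero fun i _ => if_neg ?_
      rintro rfl
      exact hn i.2
  have ham : ∀ i, a i ∈ maximalIdeal A := fun i => by
    rw [← ha]; exact Submodule.subset_span ⟨i, rfl⟩
  have hap : ∀ i, ∃ e, p.coeff e = a i := fun i => ⟨i, by simp [hpc]⟩
  have hpm : ∀ n, p.coeff n ∈ maximalIdeal A := fun n => by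
    rw [hpc]
    split_ifs
    · exact ham _
    · exact zero_mem _
  -- McCoy: a zero-divisor is killed by a non-zero constant, which would kill every `a i` and so the
  -- whole of `𝔪`.
  have hreg' : p ∈ nonZeroDivisors A[X] := by
    by_contra hcon
    obtain ⟨b, hb, hbp⟩ := Polynomial.notMem_nonZeroDivisors_iff.mp hcon
    refine hb (h b fun y hy => ?_)
    rw [← ha] at hy
    refine Submodule.span_induction (p := fun y _ => b * y = 0) ?_ (mul_zero b) ?_ ?_ hy
    · rintro _ ⟨i, rfl⟩
      obtain ⟨d, hd⟩ := hap i
      have := congrArg (fun f => coeff f d) hbp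
      simpa [hd] using this
    · intro x y _ _ hx hy
      rw [mul_add, hx, hy, add_zero]
    · intro c x _ hx
      rw [smul_eq_mul, mul_left_comm, hx, mul_zero]
  obtain ⟨n₀, hn₀⟩ := exists_forall_mem_map_C_pow (I := maximalIdeal A) ha
    (fun n => by rw [pow_one]; exact hpm n) hap
    (fun z hz => (mem_nonZeroDivisors_iff.mp hreg').1 z hz)
  let ψ := algebraMap A[X] (NagataRing A)
  have hpow : ∀ n, maximalIdeal (NagataRing A) ^ n =
      ((maximalIdeal A ^ n).map (C : A →+* A[X])).map ψ := fun n => by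
    rw [maximalIdeal_nagataRing, ← Ideal.map_pow, map_algebraMap_nagataRing]
  refine ⟨ψ p, ?_, ?_, n₀, fun n hn z hz => ?_⟩
  · rw [maximalIdeal_nagataRing, map_algebraMap_nagataRing]
    exact Ideal.mem_map_of_mem _ (Ideal.mem_map_C_iff.mpr hpm)
  · intro z hz
    obtain ⟨⟨f, s⟩, hfs⟩ := IsLocalization.surj
      ((maximalIdeal A).map (C : A →+* A[X])).primeCompl z
    have h1 : ψ (p * f) = 0 := by rw [map_mul, ← hfs, ← mul_assoc, hz, zero_mul]
    obtain ⟨t, ht⟩ := (IsLocalization.map_eq_zero_iff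
      ((maximalIdeal A).map (C : A →+* A[X])).primeCompl _ _).mp h1
    have h2 : (t : A[X]) * f = 0 := (mem_nonZeroDivisors_iff.mp hreg').1 _ (by rw [← ht]; ring)
    have h3 : ψ f = 0 := (IsLocalization.map_eq_zero_iff
      ((maximalIdeal A).map (C : A →+* A[X])).primeCompl _ _).mpr ⟨t, h2⟩
    have h4 : z * algebraMap A[X] (NagataRing A) s = 0 := hfs.trans h3
    exact (IsLocalization.map_units (NagataRing A) s).mul_left_eq_zero.mp h4
  · obtain ⟨⟨f, s⟩, hfs⟩ := IsLocalization.surj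
      ((maximalIdeal A).map (C : A →+* A[X])).primeCompl z
    have h1 : ψ (p * f) ∈ maximalIdeal (NagataRing A) ^ (n + 1) := by
      rw [map_mul, ← hfs, ← mul_assoc]
      exact Ideal.mul_mem_right _ _ hz
    rw [hpow] at h1
    obtain ⟨⟨g, t⟩, hgt⟩ := (IsLocalization.mem_map_algebraMap_iff
      ((maximalIdeal A).map (C : A →+* A[X])).primeCompl _).mp h1
    rw [← map_mul] at hgt
    obtain ⟨v, hv⟩ := (IsLocalization.eq_iff_exists
      ((maximalIdeal A).map (C : A →+* A[X])).primeCompl _).mp hgt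
    have h2 := hn₀ n hn (v * t * f) (by
      have : p * (v * t * f) = v * (p * f * t) := by ring
      rw [this, hv]
      exact Ideal.mul_mem_left _ _ g.2)
    have h3 : ψ (v * t * f) ∈ maximalIdeal (NagataRing A) ^ n := by
      rw [hpow]; exact Ideal.mem_map_of_mem _ h2
    have h4 : ψ (v * t * f) = ψ (v * t * s : A[X]) * z := by
      have : ψ f = z * ψ s := hfs.symm
      rw [map_mul, this, map_mul, map_mul, map_mul]; ring
    rw [h4] at h3
    have hu : IsUnit (ψ (v * t * s : A[X])) := IsLocalization.map_units (NagataRing A) (v * t * s)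
    exact (Ideal.unit_mul_mem_iff_mem _ hu).mp h3

/-- A superficial non-zero-divisor is not in the square of the maximal ideal. -/
theorem notMem_maximalIdeal_sq [IsNoetherianRing A] {x : A} (hxm : x ∈ maximalIdeal A)
    (hx : ∀ z, x * z = 0 → z = 0) {n₀ : ℕ}
    (hn₀ : ∀ n ≥ n₀, ∀ z, x * z ∈ maximalIdeal A ^ (n + 1) → z ∈ maximalIdeal A ^ n) :
    x ∉ maximalIdeal A ^ 2 := by
  intro h2
  -- If `z ∈ 𝔪 ^ n₀`, then `x * z ∈ 𝔪 ^ (n₀ + 2)`, hence `z ∈ 𝔪 ^ (n₀ + 1)`. By Nakayama `𝔪 ^ n₀ =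
  -- 0`, and the non-zero-divisor `x` would be nilpotent.
  have h1 : maximalIdeal A ^ n₀ ≤ maximalIdeal A • maximalIdeal A ^ n₀ := by
    intro z hz
    rw [smul_eq_mul, ← pow_succ']
    refine hn₀ (n₀ + 1) (by omega) z ?_
    rw [show n₀ + 1 + 1 = 2 + n₀ by ring, pow_add]
    exact Ideal.mul_mem_mul h2 hz
  have h3 : maximalIdeal A ^ n₀ = ⊥ :=
    Submodule.eq_bot_of_le_smul_of_le_jacobson_bot _ _ (IsNoetherian.noetherian _) h1
      (maximalIdeal_le_jacobson _)
  have h4 : x ^ n₀ = 0 := by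
    have := Ideal.pow_mem_pow hxm n₀
    rwa [h3] at this
  have h5 : ∀ n, x ^ n = 0 → (1 : A) = 0 := by
    intro n
    induction n with
    | zero => simp
    | succ n ih => exact fun h => ih (hx _ (by rw [← pow_succ']; exact h))
  exact one_ne_zero (h5 _ h4)

end Nagata

end IsLocalRing

/-! ### Exactness over the Nagata ring -/

namespace Matrix.ExactOn

variable {A : Type*} [CommRing A] [IsLocalRing A]
  {l m n : Type*} [Fintype l] [Fintype m] [Fintype n]

/-- Exactness is preserved by passing to the Nagata ring. -/
theorem map_nagataRing {I : Ideal A} {M : Matrix m l A} {N : Matrix n m A} (h : ExactOn I M N) :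
    ExactOn (I.map (algebraMap A (NagataRing A))) (M.map (algebraMap A (NagataRing A)))
      (N.map (algebraMap A (NagataRing A))) := by
  have := map_localization (B := NagataRing A)
    ((maximalIdeal A).map (C : A →+* A[X])).primeCompl (map_C h)
  rw [map_algebraMap_nagataRing, algebraMap_nagataRing]
  exact this

/-- Exactness over the Nagata ring implies exactness. -/
theorem of_nagataRing {M : Matrix m l A} {N : Matrix n m A}
    (h : ExactOn ⊤ (M.map (algebraMap A (NagataRing A))) (N.map (algebraMap A (NagataRing A)))) :
    ExactOn ⊤ M N := by
  classical
  intro u _ hu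
  obtain ⟨w', hw'⟩ := h (algebraMap A (NagataRing A) ∘ u) (fun _ => trivial) (by
    rw [map_mulVec_comp, hu]; ext; simp)
  let S := ((maximalIdeal A).map (C : A →+* A[X])).primeCompl
  obtain ⟨s, hs⟩ := IsLocalization.exist_integer_multiples_of_finite S w'
  choose w hw using hs
  have h1 : ∀ j, ∃ t : S, (t : A[X]) * (s * C (u j)) = t * (M.map C).mulVec w j := by
    intro j
    have h2 : algebraMap A[X] (NagataRing A) (s * C (u j)) =
        algebraMap A[X] (NagataRing A) ((M.map C).mulVec w j) := by
      have h3 := congrFun (map_mulVec_comp (algebraMap A[X] (NagataRing A)) (M.map C) w) j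
      rw [Function.comp_apply] at h3
      rw [← h3]
      have h4 : algebraMap A[X] (NagataRing A) ∘ w = algebraMap A[X] (NagataRing A) s • w' := by
        ext i
        rw [Function.comp_apply, hw i, Pi.smul_apply, smul_eq_mul, Algebra.smul_def]
      rw [h4, Matrix.mulVec_smul, Matrix.map_map, ← RingHom.coe_comp, ← algebraMap_nagataRing, hw',
        map_mul]
      simp [algebraMap_nagataRing]
    exact (IsLocalization.eq_iff_exists S _).mp h2
  choose t ht using h1
  have hprod : ∀ j, ((∏ i, t i : S) : A[X]) * (s * C (u j)) =
      (∏ i, t i : S) * (M.map C).mulVec w j := by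
    intro j
    rw [← Finset.prod_erase_mul _ _ (Finset.mem_univ j), Submonoid.coe_mul, mul_assoc, ht j,
      mul_assoc]
  -- The cleared denominator has a unit coefficient; comparing coefficients in its degree turns the
  -- polynomial solution into one over `A`.
  obtain ⟨i, hi⟩ := mem_primeCompl_map_C_iff.mp ((∏ i, t i : S) * s).2
  set f : A[X] := ((∏ i, t i : S) : A[X]) with hf
  have hM : M.mulVec (fun j => (f * w j).coeff i) =
      (((f * (s : A[X])).coeff i) • u) := by
    ext j
    have h1 := congrArg (fun g => coeff g i) (hprod j)
    rw [← mul_assoc, coeff_mul_C] at h1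
    rw [Pi.smul_apply, smul_eq_mul, h1]
    simp only [Matrix.mulVec, dotProduct, Matrix.map_apply, Finset.mul_sum,
      Polynomial.finsetSum_coeff]
    refine Finset.sum_congr rfl fun k _ => ?_
    rw [mul_left_comm, coeff_C_mul]
  refine ⟨(↑hi.unit⁻¹ : A) • fun j => (f * w j).coeff i, ?_⟩
  rw [Matrix.mulVec_smul, hM, smul_smul]
  have : (↑hi.unit⁻¹ : A) * (f * (s : A[X])).coeff i = 1 := hi.val_inv_mul
  rw [this, one_smul]

end Matrix.ExactOn

/-! ### Backward differences of polynomials -/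

namespace Polynomial

/-- The backward difference `P(X) - P(X - 1)` of a polynomial. -/
noncomputable def backwardDiff (P : ℚ[X]) : ℚ[X] := P - taylor (-1) P

theorem eval_backwardDiff (P : ℚ[X]) (t : ℚ) :
    P.backwardDiff.eval t = P.eval t - P.eval (t - 1) := by
  rw [backwardDiff, eval_sub, taylor_eval, sub_eq_add_neg t]

/-- The coefficient of degree `D` in `P(X - 1)` is the value at `-1` of the `D`-th Hasse derivative,
which is affine linear because of the degree bound. -/
theorem backwardDiff_coeff {P : ℚ[X]} {D : ℕ} (hD : P.natDegree ≤ D + 1) :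
    P.backwardDiff.coeff D = (D + 1) * P.coeff (D + 1) := by
  have h1 : (hasseDeriv D P).natDegree ≤ 1 :=
    (natDegree_hasseDeriv_le P D).trans (by omega)
  have h2 : hasseDeriv D P = C ((hasseDeriv D P).coeff 1) * X + C ((hasseDeriv D P).coeff 0) :=
    eq_X_add_C_of_natDegree_le_one h1
  rw [backwardDiff, coeff_sub, taylor_coeff, h2]
  simp [hasseDeriv_coeff, Nat.add_comm 1 D]

theorem natDegree_backwardDiff_lt {P : ℚ[X]} {D : ℕ} (hD : P.natDegree ≤ D + 1) :
    P.backwardDiff.natDegree ≤ D := by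
  rw [natDegree_le_iff_coeff_eq_zero]
  intro N hN
  have h1 : P.natDegree ≤ N := by omega
  rw [backwardDiff_coeff (h1.trans (Nat.le_succ N)),
    coeff_eq_zero_of_natDegree_lt (Nat.lt_succ_of_le h1), mul_zero]

theorem backwardDiff_of_natDegree_eq_zero {P : ℚ[X]} (hP : P.natDegree = 0) :
    P.backwardDiff = 0 := by
  rw [eq_C_of_natDegree_eq_zero hP, backwardDiff, taylor_C, sub_self]

/-- If the `s`-th difference of `P` is a non-zero constant `c`, then `P` has degree `s` and `c` is
`s !` times the leading coefficient of `P`. -/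
theorem factorial_mul_leadingCoeff_of_backwardDiff_iterate {s : ℕ} {P : ℚ[X]} {c : ℚ}
    (hc : c ≠ 0) (h : backwardDiff^[s] P = C c) :
    P.natDegree = s ∧ (s.factorial : ℚ) * P.leadingCoeff = c := by
  induction s generalizing P with
  | zero =>
    rw [Function.iterate_zero, id] at h
    simp [h]
  | succ s ih =>
    rw [Function.iterate_succ_apply] at h
    obtain ⟨h1, h2⟩ := ih h
    obtain ⟨D, hD⟩ : ∃ D, P.natDegree = D + 1 := by
      refine Nat.exists_eq_succ_of_ne_zero fun h0 => hc ?_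
      rw [backwardDiff_of_natDegree_eq_zero h0, natDegree_zero] at h1
      rw [backwardDiff_of_natDegree_eq_zero h0] at h2
      simpa using h2.symm
    have h3 : P.backwardDiff.coeff D ≠ 0 := by
      rw [backwardDiff_coeff hD.le, ← hD, coeff_natDegree]
      have : P ≠ 0 := by rintro rfl; simp at hD
      have := leadingCoeff_ne_zero.mpr this
      positivity
    have h4 : P.backwardDiff.natDegree = D :=
      natDegree_eq_of_le_of_coeff_ne_zero (natDegree_backwardDiff_lt hD.le) h3
    have h5 : D = s := h4.symm.trans h1
    subst h5
    refine ⟨hD, ?_⟩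
    rw [leadingCoeff, h4, backwardDiff_coeff hD.le, ← hD, coeff_natDegree] at h2
    rw [← h2, Nat.factorial_succ]
    push_cast
    ring

end Polynomial

/-! ### Lengths and Hilbert-Samuel polynomials under reduction -/

namespace IsLocalRing

section Length

variable (A : Type*) [CommRing A] [IsLocalRing A] [IsNoetherianRing A]

theorem length_quotient_maximalIdeal_pow_ne_top (n : ℕ) :
    Module.length A (A ⧸ maximalIdeal A ^ n) ≠ ⊤ := by
  rcases Nat.eq_zero_or_pos n with rfl | hn
  · have : Subsingleton (A ⧸ maximalIdeal A ^ 0) := by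
      rw [Ideal.Quotient.subsingleton_iff]; simp
    rw [Module.length_eq_zero]
    exact ENat.zero_ne_top
  · have : IsArtinianRing (A ⧸ maximalIdeal A ^ n) := by
      refine quotient_artinian_of_mem_minimalPrimes_of_isLocalRing _ ⟨⟨inferInstance,
        Ideal.pow_le_self hn.ne'⟩, fun q hq _ => ?_⟩
      have := hq.1
      exact Ideal.IsPrime.le_of_pow_le hq.2
    rw [Module.length_eq_of_surjective (R := A ⧸ maximalIdeal A ^ n) (S := A)
      Ideal.Quotient.mk_surjective]
    exact Module.length_ne_top

instance : IsLocalHom (algebraMap A (NagataRing A)) := by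
  refine ⟨fun a ha => ?_⟩
  by_contra h
  have h1 : a ∈ maximalIdeal A := h
  have h2 : algebraMap A (NagataRing A) a ∈ maximalIdeal (NagataRing A) := by
    rw [maximalIdeal_nagataRing]; exact Ideal.mem_map_of_mem _ h1
  exact h2 ha

instance : Module.Flat A (NagataRing A) := Module.Flat.trans A A[X] (NagataRing A)

/-- Flat local base change multiplies length by that of the closed fibre, here a field since `𝔪`
generates the maximal ideal of `A(X)`. -/
theorem length_nagataRing_quotient_maximalIdeal_pow (n : ℕ) :
    Module.length (NagataRing A) (NagataRing A ⧸ maximalIdeal (NagataRing A) ^ n) =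
      Module.length A (A ⧸ maximalIdeal A ^ n) := by
  have h := length_baseChange A (NagataRing A) (A ⧸ maximalIdeal A ^ n)
  rw [← maximalIdeal_nagataRing] at h
  have h1 : Module.length (NagataRing A) (NagataRing A ⧸ maximalIdeal (NagataRing A)) = 1 := by
    rw [Module.length_eq_one_iff, isSimpleModule_iff_isCoatom]
    exact (maximalIdeal.isMaximal (NagataRing A)).out
  rw [h1, mul_one,
    ← (Algebra.TensorProduct.quotIdealMapEquivTensorQuot (NagataRing A)
      (maximalIdeal A ^ n)).toLinearEquiv.length_eq, Ideal.map_pow, ← maximalIdeal_nagataRing] at h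
  exact h

variable {A}

theorem length_quotient_span_singleton_quotient_maximalIdeal_pow (x : A)
    [IsLocalRing (A ⧸ Ideal.span {x})] (n : ℕ) :
    Module.length (A ⧸ Ideal.span {x})
        ((A ⧸ Ideal.span {x}) ⧸ maximalIdeal (A ⧸ Ideal.span {x}) ^ n) =
      Module.length A (A ⧸ (maximalIdeal A ^ n ⊔ Ideal.span {x})) := by
  set B := A ⧸ Ideal.span {x}
  have hmap : maximalIdeal B ^ n = (maximalIdeal A ^ n).map (Ideal.Quotient.mk (Ideal.span {x})) := by
    rw [Ideal.map_pow, IsLocalRing.map_maximalIdeal_of_surjective _ Ideal.Quotient.mk_surjective]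
  rw [← Module.length_eq_of_surjective (R := B) (S := A) Ideal.Quotient.mk_surjective]
  let f : A →ₗ[A] B ⧸ maximalIdeal B ^ n :=
    ((Submodule.mkQ (maximalIdeal B ^ n)).restrictScalars A).comp (Algebra.linearMap A B)
  have hf : Function.Surjective f :=
    (Submodule.mkQ_surjective _).comp Ideal.Quotient.mk_surjective
  have hker : LinearMap.ker f = maximalIdeal A ^ n ⊔ Ideal.span {x} := by
    ext a
    have : f a = Ideal.Quotient.mk (maximalIdeal B ^ n) (Ideal.Quotient.mk (Ideal.span {x}) a) := rfl
    rw [LinearMap.mem_ker, this, Ideal.Quotient.eq_zero_iff_mem, hmap, ← Ideal.mem_comap,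
      Ideal.comap_map_of_surjective _ Ideal.Quotient.mk_surjective, ← RingHom.ker_eq_comap_bot,
      Ideal.mk_ker]
  rw [← (f.quotKerEquivOfSurjective hf).length_eq, hker]

/-- Multiplication by `x` gives a right exact sequence `A/I → A/J → A/(J + xA) → 0`; the extra
condition is injectivity on the left. -/
theorem length_quotient_le {x : A} {I J : Ideal A} (h : ∀ a ∈ I, x * a ∈ J) :
    Module.length A (A ⧸ J) ≤ Module.length A (A ⧸ I) + Module.length A (A ⧸ (J ⊔ Ideal.span {x})) ∧
    ((∀ a, x * a ∈ J → a ∈ I) → Module.length A (A ⧸ J) =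
      Module.length A (A ⧸ I) + Module.length A (A ⧸ (J ⊔ Ideal.span {x}))) := by
  let f : A ⧸ I →ₗ[A] A ⧸ J := Submodule.mapQ I J (LinearMap.mulLeft A x) h
  let g : A ⧸ J →ₗ[A] A ⧸ (J ⊔ Ideal.span {x}) := Submodule.factor le_sup_left
  have hg : Function.Surjective g := Submodule.factor_surjective _
  have hfg : Function.Exact f g := by
    intro y
    obtain ⟨y, rfl⟩ := Submodule.mkQ_surjective _ y
    have h1 : g (J.mkQ y) = (J ⊔ Ideal.span {x}).mkQ y := rfl
    rw [h1, Submodule.mkQ_apply, Submodule.Quotient.mk_eq_zero]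
    constructor
    · intro hy
      obtain ⟨j, hj, z, hz, rfl⟩ := Submodule.mem_sup.mp hy
      obtain ⟨a, rfl⟩ := Ideal.mem_span_singleton.mp hz
      refine ⟨I.mkQ a, ?_⟩
      have : f (I.mkQ a) = J.mkQ (x * a) := rfl
      rw [this, ← sub_eq_zero, ← map_sub, Submodule.mkQ_apply, Submodule.Quotient.mk_eq_zero]
      have : x * a - (j + x * a) = -j := by ring
      rw [this]
      exact neg_mem hj
    · rintro ⟨a, ha⟩
      obtain ⟨a, rfl⟩ := Submodule.mkQ_surjective _ a
      have : f (I.mkQ a) = J.mkQ (x * a) := rfl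
      rw [this, eq_comm, ← sub_eq_zero, ← map_sub, Submodule.mkQ_apply,
        Submodule.Quotient.mk_eq_zero] at ha
      have h2 : y = (y - x * a) + x * a := by ring
      rw [h2]
      exact Submodule.add_mem_sup ha (Ideal.mem_span_singleton.mpr ⟨a, rfl⟩)
  have hker : Function.Exact (LinearMap.range f).subtype g := by
    rw [LinearMap.exact_iff, Submodule.range_subtype]
    exact LinearMap.exact_iff.mp hfg
  have h1 := Module.length_eq_add_of_exact (LinearMap.range f).subtype g
    (Submodule.subtype_injective _) hg hker
  refine ⟨?_, fun hinj => ?_⟩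
  · rw [h1]
    gcongr
    exact Module.length_le_of_surjective _ f.surjective_rangeRestrict
  · refine Module.length_eq_add_of_exact f g ?_ hg hfg
    rw [← LinearMap.ker_eq_bot, Submodule.eq_bot_iff]
    intro a ha
    obtain ⟨a, rfl⟩ := Submodule.mkQ_surjective _ a
    have h2 : f (I.mkQ a) = J.mkQ (x * a) := rfl
    rw [LinearMap.mem_ker, h2, Submodule.mkQ_apply, Submodule.Quotient.mk_eq_zero] at ha
    rw [Submodule.mkQ_apply, Submodule.Quotient.mk_eq_zero]
    exact hinj a ha

end Length

section HilbertSamuel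

variable {A : Type u} [CommRing A] [IsLocalRing A] [IsNoetherianRing A]

theorem isHilbertSamuelPolynomial_nagataRing {P : ℚ[X]} (h : IsHilbertSamuelPolynomial A P) :
    IsHilbertSamuelPolynomial (NagataRing A) P := by
  filter_upwards [h] with n hn
  rw [hn, length_nagataRing_quotient_maximalIdeal_pow]

/-- For large `n` the colon condition makes `0 → A/𝔪ⁿ → A/𝔪ⁿ⁺¹ → A/(𝔪ⁿ⁺¹ + xA) → 0` exact, so the
new length function is the difference of two consecutive old values. -/
theorem isHilbertSamuelPolynomial_quotient {P : ℚ[X]} (h : IsHilbertSamuelPolynomial A P) {x : A}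
    (hxm : x ∈ maximalIdeal A) {n₀ : ℕ}
    (hn₀ : ∀ n ≥ n₀, ∀ z, x * z ∈ maximalIdeal A ^ (n + 1) → z ∈ maximalIdeal A ^ n)
    [IsLocalRing (A ⧸ Ideal.span {x})] :
    IsHilbertSamuelPolynomial (A ⧸ Ideal.span {x}) P.backwardDiff := by
  obtain ⟨N, hN⟩ := Filter.eventually_atTop.mp h
  refine Filter.eventually_atTop.mpr ⟨N + 1 + n₀, fun n hn => ?_⟩
  obtain ⟨k, rfl⟩ : ∃ k, n = k + 1 := ⟨n - 1, by omega⟩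
  have h1 := (length_quotient_le (x := x) (I := maximalIdeal A ^ (k + 1))
    (J := maximalIdeal A ^ (k + 1 + 1)) (fun a ha => by
      rw [pow_succ']; exact Ideal.mul_mem_mul hxm ha)).2 (hn₀ (k + 1) (by omega))
  have h2 := hN (k + 1) (by omega)
  have h3 := hN k (by omega)
  have h4 := length_quotient_maximalIdeal_pow_ne_top A (k + 1)
  have h5 := length_quotient_maximalIdeal_pow_ne_top A (k + 1 + 1)
  rw [length_quotient_span_singleton_quotient_maximalIdeal_pow, eval_backwardDiff, h2]
  have h6 : ((k + 1 : ℕ) : ℚ) - 1 = k := by push_cast; ring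
  rw [h6, h3]
  have h7 : Module.length A (A ⧸ (maximalIdeal A ^ (k + 1 + 1) ⊔ Ideal.span {x})) ≠ ⊤ := by
    intro htop
    rw [htop, add_top] at h1
    exact h5 h1
  rw [h1, ENat.toNat_add h4 h7]
  push_cast
  ring

theorem isNilpotent_maximalIdeal_of_ringKrullDim_le (h : ringKrullDim A ≤ 0) :
    IsNilpotent (maximalIdeal A) := by
  rw [← isArtinianRing_iff_isNilpotent_maximalIdeal, isArtinianRing_iff_krullDimLE_zero]
  exact (Ring.krullDimLE_iff).mpr h

theorem hilbertSamuelPolynomial_eq_C {P : ℚ[X]} (hP : IsHilbertSamuelPolynomial A P)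
    (h : ringKrullDim A ≤ 0) : P = C ((Module.length A A).toNat : ℚ) := by
  obtain ⟨k, hk⟩ := isNilpotent_maximalIdeal_of_ringKrullDim_le h
  obtain ⟨N, hN⟩ := Filter.eventually_atTop.mp hP
  refine Polynomial.eq_of_infinite_eval_eq _ _ ?_
  refine Set.Infinite.mono (s := Set.range fun n : ℕ => ((n + N + k : ℕ) : ℚ)) ?_ ?_
  · rintro _ ⟨n, rfl⟩
    simp only [Set.mem_ofPred, eval_C]
    rw [hN _ (by omega)]
    have : maximalIdeal A ^ (n + N + k + 1) = ⊥ := by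
      rw [show n + N + k + 1 = k + (n + N + 1) by ring, pow_add, hk]
      simp
    rw [this, (Submodule.quotEquivOfEqBot (⊥ : Submodule A A) rfl).length_eq]
  · refine Set.infinite_range_of_injective fun a b hab => ?_
    have : a + N + k = b + N + k := Nat.cast_injective hab
    omega

/-- The kernel of `A/𝔪² → A/(𝔪² + xA)` is an image of `A/𝔪`, hence of length at most one. -/
theorem length_quotient_maximalIdeal_sq_le {x : A} (hxm : x ∈ maximalIdeal A)
    [IsLocalRing (A ⧸ Ideal.span {x})] :
    (Module.length A (A ⧸ maximalIdeal A ^ 2)).toNat ≤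
      (Module.length (A ⧸ Ideal.span {x}) ((A ⧸ Ideal.span {x}) ⧸
        maximalIdeal (A ⧸ Ideal.span {x}) ^ 2)).toNat + 1 := by
  have h0 := length_quotient_maximalIdeal_pow_ne_top (A ⧸ Ideal.span {x}) 2
  rw [length_quotient_span_singleton_quotient_maximalIdeal_pow] at h0 ⊢
  have h1 := (length_quotient_le (x := x) (I := maximalIdeal A) (J := maximalIdeal A ^ 2)
    (fun a ha => by rw [pow_two]; exact Ideal.mul_mem_mul hxm ha)).1
  have h2 : Module.length A (A ⧸ maximalIdeal A) = 1 := by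
    rw [Module.length_eq_one_iff, isSimpleModule_iff_isCoatom]
    exact (maximalIdeal.isMaximal A).out
  rw [h2] at h1
  have := ENat.toNat_le_toNat h1 (by simp [h0])
  rw [ENat.toNat_add (by simp) h0] at this
  simpa [Nat.add_comm] using this

theorem maximalIdeal_sq_eq_bot_of_length_le (h : ringKrullDim A ≤ 0)
    (hle : (Module.length A A).toNat ≤ (Module.length A (A ⧸ maximalIdeal A ^ 2)).toNat) :
    maximalIdeal A ^ 2 = ⊥ := by
  have : IsArtinianRing A :=
    (isArtinianRing_iff_isNilpotent_maximalIdeal A).mpr (isNilpotent_maximalIdeal_of_ringKrullDim_le h)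
  by_contra hne
  have h1 := Submodule.length_quotient_lt (R := A) (M := A) (maximalIdeal A ^ 2) hne
  have h2 : Module.length A A ≠ ⊤ := Module.length_ne_top
  rw [← ENat.natCast_toNat h2, ← ENat.natCast_toNat (length_quotient_maximalIdeal_pow_ne_top A 2),
    Nat.cast_lt] at h1
  omega

/-- Additivity of length on `0 → 𝔪/𝔪² → A/𝔪² → k → 0`. -/
theorem length_quotient_maximalIdeal_sq :
    (Module.length A (A ⧸ maximalIdeal A ^ 2)).toNat = (maximalIdeal A).spanFinrank + 1 := by
  let f := (maximalIdeal A).cotangentToQuotientSquare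
  let g : A ⧸ maximalIdeal A ^ 2 →ₗ[A] A ⧸ maximalIdeal A :=
    Submodule.factor (Ideal.pow_le_self two_ne_zero)
  have hg : Function.Surjective g := Submodule.factor_surjective _
  have hf : Function.Injective f := Ideal.cotangentToQuotientSquare_injective _
  have hfg : Function.Exact f g := by
    intro y
    obtain ⟨y, rfl⟩ := Submodule.mkQ_surjective _ y
    have h1 : g ((maximalIdeal A ^ 2).mkQ y) = (maximalIdeal A).mkQ y := rfl
    rw [h1, Submodule.mkQ_apply, Submodule.Quotient.mk_eq_zero]
    constructor
    · intro hy
      exact ⟨(maximalIdeal A).toCotangent ⟨y, hy⟩, Ideal.toCotangent_to_quotient_square _ _⟩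
    · rintro ⟨z, hz⟩
      obtain ⟨z, rfl⟩ := (maximalIdeal A).toCotangent_surjective z
      have h3 : (maximalIdeal A ^ 2).mkQ (z : A) = (maximalIdeal A ^ 2).mkQ y := hz
      rw [eq_comm, ← sub_eq_zero, ← map_sub, Submodule.mkQ_apply,
        Submodule.Quotient.mk_eq_zero] at h3
      simpa using add_mem (Ideal.pow_le_self two_ne_zero h3) z.2
  have h2 : Module.length A (A ⧸ maximalIdeal A) = 1 := by
    rw [Module.length_eq_one_iff, isSimpleModule_iff_isCoatom]
    exact (maximalIdeal.isMaximal A).out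
  have h3 : Module.length A (maximalIdeal A).Cotangent = ((maximalIdeal A).spanFinrank : ℕ∞) := by
    rw [spanFinrank_maximalIdeal_eq_finrank_cotangentSpace, ← Module.length_eq_finrank]
    exact Module.length_eq_of_surjective (R := ResidueField A) (S := A)
      (M := (maximalIdeal A).Cotangent) Ideal.Quotient.mk_surjective
  rw [Module.length_eq_add_of_exact f g hf hg hfg, h2, h3]
  exact ENat.toNat_natCast (_ + 1)

end HilbertSamuel

end IsLocalRing

/-! ### The case `𝔪² = 0` and the induction on dimension -/

namespace IsLocalRing

variable {A : Type*} [CommRing A] [IsLocalRing A]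

/-- Suppose that `T₀` presents a non-zero module killed by the maximal ideal, and that the dual of
a complex `T₁`, `T₀` is exact. Then each linear map `𝔪 → A` is a multiplication. -/
theorem exists_eq_mul_of_exactOn_transpose {k l m : Type*} [Fintype k] [Fintype l] [Fintype m]
    {T₀ : Matrix m l A} {T₁ : Matrix l k A} (hT : T₀ * T₁ = 0)
    (hTd : Matrix.ExactOn ⊤ T₀.transpose T₁.transpose) {Λ : m → A} {j : m} (hj : Λ j = 1)
    (hΛ : ∀ i, T₀.transpose.mulVec Λ i ∈ maximalIdeal A)
    (hk : ∀ u, ∀ a ∈ maximalIdeal A, ∃ w, T₀.mulVec w = a • u)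
    (φ : maximalIdeal A →ₗ[A] A) : ∃ c, ∀ a, φ a = c * a := by
  classical
  let Λ' : l → maximalIdeal A := fun i => ⟨T₀.transpose.mulVec Λ i, hΛ i⟩
  have hsum : ∀ w : l → A, ((∑ i, w i • Λ' i : maximalIdeal A) : A) = Λ ⬝ᵥ T₀.mulVec w := by
    intro w
    rw [Matrix.dotProduct_mulVec, ← Matrix.mulVec_transpose, dotProduct_comm]
    simp [dotProduct, Λ']
  -- `φ ∘ Λ ∘ T₀` vanishes on the image of `T₁`, so it equals `ψ ∘ T₀`. For `a ∈ 𝔪` the vector `a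
  -- eⱼ` is some `T₀ w`, and `Λ (a eⱼ) = a`; hence `φ a = ψⱼ a`.
  obtain ⟨ψ, hψ⟩ := hTd (fun i => φ (Λ' i)) (fun _ => trivial) (by
    ext a
    have h1 : ∑ i, T₁ i a • Λ' i = 0 := by
      refine Subtype.ext ?_
      rw [hsum (fun i => T₁ i a)]
      have : T₀.mulVec (fun i => T₁ i a) = 0 := by
        have := congrArg (fun M : Matrix m k A => fun b => M b a) hT
        exact this
      rw [this, dotProduct_zero]
      rfl
    have h2 := congrArg φ h1
    rw [map_sum, map_zero] at h2
    simpa [Matrix.mulVec, dotProduct] using h2)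
  refine ⟨ψ j, fun a => ?_⟩
  obtain ⟨w, hw⟩ := hk (Pi.single j 1) a a.2
  have h1 : ∑ i, w i • Λ' i = a := by
    refine Subtype.ext ?_
    rw [hsum, hw, dotProduct_smul, dotProduct_single, hj]
    simp
  have h2 : ∑ i, w i * φ (Λ' i) = ψ j * a := by
    have h3 : ∑ i, w i * φ (Λ' i) = (fun i => φ (Λ' i)) ⬝ᵥ w := by
      simp [dotProduct, mul_comm]
    rw [h3, ← hψ, Matrix.mulVec_transpose, ← Matrix.dotProduct_mulVec, hw, dotProduct_smul,
      dotProduct_single]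
    simp [mul_comm]
  rw [← h2, ← h1, map_sum]
  simp

/-- Let `𝔪² = 0` and let each linear map `𝔪 → A` be a multiplication. Then the dual of an exact pair
of matrices is exact, if the second matrix has entries in `𝔪`. -/
theorem exactOn_transpose_of_maximalIdeal_sq_eq_bot (hm : maximalIdeal A ^ 2 = ⊥)
    (hφ : ∀ φ : maximalIdeal A →ₗ[A] A, ∃ c, ∀ a, φ a = c * a)
    {k l m : Type*} [Fintype k] [Fintype l] [Fintype m] {M : Matrix l k A} {N : Matrix m l A}
    (hN : ∀ i j, N i j ∈ maximalIdeal A) (h : Matrix.ExactOn ⊤ M N) :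
    Matrix.ExactOn ⊤ N.transpose M.transpose := by
  classical
  intro φ _ hMφ
  have hss : IsSemisimpleModule A (m → maximalIdeal A) := by
    have ht : Module.IsTorsionBySet A (m → maximalIdeal A) (maximalIdeal A) := by
      intro x a
      ext i
      have : (a : A) * x i ∈ maximalIdeal A ^ 2 := by
        rw [pow_two]; exact Ideal.mul_mem_mul a.2 (x i).2
      rw [hm] at this
      simpa using this
    let := ht.module
    let := Ideal.Quotient.field (maximalIdeal A)
    exact ht.isSemisimpleModule_iff.mp inferInstance
  let δ : (l → A) →ₗ[A] (m → maximalIdeal A) :=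
    LinearMap.pi fun i => ((LinearMap.proj i).comp N.mulVecLin).codRestrict (maximalIdeal A)
      fun w => Ideal.sum_mem _ fun j _ => Ideal.mul_mem_right _ _ (hN i j)
  have hδ : ∀ w i, (δ w i : A) = N.mulVec w i := fun _ _ => rfl
  let Φ : (l → A) →ₗ[A] A := Fintype.linearCombination A φ
  have hΦ : ∀ w, Φ w = φ ⬝ᵥ w := fun w => by
    simp [Φ, Fintype.linearCombination_apply, dotProduct, mul_comm]
  have hker : LinearMap.ker δ ≤ LinearMap.ker Φ := by
    intro w hw
    obtain ⟨v, rfl⟩ := h w (fun _ => trivial) (by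
      ext i
      rw [← hδ, LinearMap.mem_ker.mp hw]
      rfl)
    rw [LinearMap.mem_ker, hΦ, Matrix.dotProduct_mulVec, ← Matrix.mulVec_transpose, hMφ,
      zero_dotProduct]
  -- `Φ` factors through the image of `N`, a subspace of a finite power of `𝔪`, which is a vector
  -- space over `k` as `𝔪² = 0`. It therefore extends to the whole power, and each component of the
  -- extension is a map `𝔪 → A`, hence a multiplication.
  obtain ⟨Ψ, hΨ⟩ := IsSemisimpleModule.extension_property ((LinearMap.ker δ).liftQ δ le_rfl)
    (by rw [← LinearMap.ker_eq_bot]; exact Submodule.ker_liftQ_eq_bot _ _ _ le_rfl)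
    ((LinearMap.ker δ).liftQ Φ hker)
  have hΨδ : ∀ w, Ψ (δ w) = Φ w := fun w => by
    have := LinearMap.congr_fun hΨ ((LinearMap.ker δ).mkQ w)
    simpa using this
  choose ψ hψ using fun i => hφ (Ψ.comp (LinearMap.single A (fun _ : m => maximalIdeal A) i))
  have hΨψ : ∀ v, Ψ v = ∑ i, ψ i * v i := by
    intro v
    conv_lhs => rw [← Finset.univ_sum_single v]
    rw [map_sum]
    exact Finset.sum_congr rfl fun i _ => hψ i (v i)
  refine ⟨ψ, ?_⟩
  ext j
  have h1 := hΨδ (Pi.single j 1)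
  rw [hΦ, dotProduct_single, mul_one, hΨψ] at h1
  rw [← h1]
  simp [Matrix.mulVec, dotProduct, hδ, mul_comm, Pi.single_apply]

/-- The matrices of a minimal complex `D` and a complex `T`, with maps from the cokernels of the
differentials of `D` to the cokernel of the first differential of `T` that are jointly surjective,
and a functional `Λ` showing that the latter cokernel is not zero. -/
structure SyzygyData (A : Type*) [CommRing A] [IsLocalRing A] (c t : ℕ → ℕ) {r : ℕ}
    (n : Fin r → ℕ) where
  /-- the differentials of the minimal complex -/
  D : ∀ n, Matrix (Fin (c n)) (Fin (c (n + 1))) A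
  /-- the differentials of the second complex -/
  T : ∀ n, Matrix (Fin (t n)) (Fin (t (n + 1))) A
  /-- the maps from cokernels of the minimal complex -/
  B : ∀ i, Matrix (Fin (t 0)) (Fin (c (n i + 1))) A
  /-- the lifts of the relations -/
  E : ∀ i, Matrix (Fin (t 1)) (Fin (c (n i + 1 + 1))) A
  /-- the preimages of the basis vectors -/
  U : ∀ i, Matrix (Fin (c (n i + 1))) (Fin (t 0)) A
  /-- the preimages of the basis vectors, up to relations -/
  V : Matrix (Fin (t 1)) (Fin (t 0)) A
  /-- a functional that is minimal on the relations -/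
  Λ : Fin (t 0) → A
  /-- an index where `Λ` takes the value `1` -/
  j : Fin (t 0)
  D_mul_D : ∀ n, D n * D (n + 1) = 0
  D_mem : ∀ n i k, D n i k ∈ maximalIdeal A
  T_mul_T : ∀ n, T n * T (n + 1) = 0
  B_mul_D : ∀ i, B i * D (n i + 1) = T 0 * E i
  sum_B_mul_U : ∑ i, B i * U i + T 0 * V = 1
  Λ_j : Λ j = 1
  Λ_mem : ∀ i, (T 0).transpose.mulVec Λ i ∈ maximalIdeal A

namespace SyzygyData

variable {c t : ℕ → ℕ} {r : ℕ} {n : Fin r → ℕ}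

/-- Base change of the data along a local homomorphism. -/
def map (S : SyzygyData A c t n) {A' : Type*} [CommRing A'] [IsLocalRing A'] (φ : A →+* A')
    (hφ : ∀ a ∈ maximalIdeal A, φ a ∈ maximalIdeal A') : SyzygyData A' c t n where
  D n := (S.D n).map φ
  T n := (S.T n).map φ
  B i := (S.B i).map φ
  E i := (S.E i).map φ
  U i := (S.U i).map φ
  V := S.V.map φ
  Λ := φ ∘ S.Λ
  j := S.j
  D_mul_D n := by rw [← Matrix.map_mul, S.D_mul_D, Matrix.map_zero _ (map_zero φ)]
  D_mem n i k := hφ _ (S.D_mem n i k)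
  T_mul_T n := by rw [← Matrix.map_mul, S.T_mul_T, Matrix.map_zero _ (map_zero φ)]
  B_mul_D i := by rw [← Matrix.map_mul, S.B_mul_D, Matrix.map_mul]
  sum_B_mul_U := by
    have h := congrArg (φ.mapMatrix) S.sum_B_mul_U
    rw [map_add, map_sum, map_one] at h
    rw [← h]
    simp only [RingHom.mapMatrix_apply, Matrix.map_mul]
  Λ_j := by simp [S.Λ_j]
  Λ_mem i := by
    rw [← Matrix.transpose_map, Matrix.ExactOn.map_mulVec_comp]
    exact hφ _ (S.Λ_mem i)

/-- The exactness properties of the data, where `s` is the depth of the ring. -/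
structure IsAdapted (S : SyzygyData A c t n) (d s : ℕ) : Prop where
  minimal : ∀ n, Matrix.ExactOn (maximalIdeal A) (S.D (n + 1)) (S.D n)
  exact_D : ∀ n, d < n + s → Matrix.ExactOn ⊤ (S.D (n + 1)) (S.D n)
  exact_D_transpose : ∀ n < s, Matrix.ExactOn ⊤ (S.D n).transpose (S.D (n + 1)).transpose
  exact_T_transpose : ∀ n, Matrix.ExactOn ⊤ (S.T n).transpose (S.T (n + 1)).transpose

variable {S : SyzygyData A c t n} {d s : ℕ}

theorem transpose_mul_transpose (S : SyzygyData A c t n) (n : ℕ) :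
    (S.D (n + 1)).transpose * (S.D n).transpose = 0 := by
  rw [← Matrix.transpose_mul, S.D_mul_D, Matrix.transpose_zero]

theorem transpose_T_mul_transpose_T (S : SyzygyData A c t n) (n : ℕ) :
    (S.T (n + 1)).transpose * (S.T n).transpose = 0 := by
  rw [← Matrix.transpose_mul, S.T_mul_T, Matrix.transpose_zero]

theorem algebraMap_nagataRing_mem (a : A) (ha : a ∈ maximalIdeal A) :
    algebraMap A (NagataRing A) a ∈ maximalIdeal (NagataRing A) := by
  rw [maximalIdeal_nagataRing]; exact Ideal.mem_map_of_mem _ ha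

theorem IsAdapted.nagataRing (h : S.IsAdapted d s) :
    (S.map (algebraMap A (NagataRing A)) algebraMap_nagataRing_mem).IsAdapted d s where
  minimal n := by
    rw [maximalIdeal_nagataRing]; exact (h.minimal n).map_nagataRing
  exact_D n hn := by
    have := (h.exact_D n hn).map_nagataRing
    rwa [Ideal.map_top] at this
  exact_D_transpose n hn := by
    have := (h.exact_D_transpose n hn).map_nagataRing
    rwa [Ideal.map_top] at this
  exact_T_transpose n := by
    have := (h.exact_T_transpose n).map_nagataRing
    rwa [Ideal.map_top] at this

theorem mk_mem {x : A} [IsLocalRing (A ⧸ Ideal.span {x})] (a : A) (ha : a ∈ maximalIdeal A) :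
    Ideal.Quotient.mk (Ideal.span {x}) a ∈ maximalIdeal (A ⧸ Ideal.span {x}) := by
  rw [← IsLocalRing.map_maximalIdeal_of_surjective _ Ideal.Quotient.mk_surjective]
  exact Ideal.mem_map_of_mem _ ha

/-- Exactness of `D` modulo `x` at an index needs exactness over `A` there and at the index below,
and that of the duals there and at the index above; this is why both ranges depend on `s`. Exactness
on `𝔪`-vectors loses nothing: below index `0` there is only the zero module, as `c 0 = 0`. -/
theorem IsAdapted.quotient (h : S.IsAdapted d (s + 1)) (hs : s ≤ d) (hc : c 0 = 0) {x : A}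
    (hxm : x ∈ maximalIdeal A) (hx2 : x ∉ maximalIdeal A ^ 2) (hx : ∀ a, x * a = 0 → a = 0)
    [IsLocalRing (A ⧸ Ideal.span {x})] :
    (S.map (Ideal.Quotient.mk (Ideal.span {x})) mk_mem).IsAdapted d s where
  minimal n := by
    rcases n with _ | n
    · refine (h.minimal 0).quotient_maximalIdeal Ideal.Quotient.mk_surjective hxm hx2
        Ideal.mk_ker hx (P := (0 : Matrix (Fin 0) (Fin (c 0)) A)) (Matrix.zero_mul _)
        (S.D_mem 0) fun u _ _ => ⟨0, ?_⟩
      ext i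
      exact (Fin.cast hc i).elim0
    · exact (h.minimal (n + 1)).quotient_maximalIdeal Ideal.Quotient.mk_surjective hxm hx2
        Ideal.mk_ker hx (S.D_mul_D n) (S.D_mem (n + 1)) (h.minimal n)
  exact_D n hn := by
    obtain ⟨n, rfl⟩ : ∃ k, n = k + 1 := ⟨n - 1, by omega⟩
    exact (h.exact_D (n + 1) (by omega)).quotient Ideal.Quotient.mk_surjective Ideal.mk_ker hx
      (S.D_mul_D n) (h.exact_D n (by omega))
  exact_D_transpose n hn :=
    (h.exact_D_transpose n (by omega)).quotient Ideal.Quotient.mk_surjective Ideal.mk_ker hx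
      (S.transpose_mul_transpose (n + 1)) (h.exact_D_transpose (n + 1) (by omega))
  exact_T_transpose n :=
    (h.exact_T_transpose n).quotient Ideal.Quotient.mk_surjective Ideal.mk_ker hx
      (S.transpose_T_mul_transpose_T (n + 1)) (h.exact_T_transpose (n + 1))

theorem exactOn_transpose_of_quotient [IsNoetherianRing A] (S : SyzygyData A c t n) {x : A}
    (hxm : x ∈ maximalIdeal A) (hx : ∀ a, x * a = 0 → a = 0) [IsLocalRing (A ⧸ Ideal.span {x})]
    {k : ℕ} (h : Matrix.ExactOn ⊤
      ((S.map (Ideal.Quotient.mk (Ideal.span {x})) mk_mem).D k).transpose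
      ((S.map (Ideal.Quotient.mk (Ideal.span {x})) mk_mem).D (k + 1)).transpose) :
    Matrix.ExactOn ⊤ (S.D k).transpose (S.D (k + 1)).transpose :=
  Matrix.ExactOn.of_quotient Ideal.Quotient.mk_surjective hxm Ideal.mk_ker hx
    (S.transpose_mul_transpose k) h

/-- The case of a ring whose maximal ideal has square zero. -/
theorem IsAdapted.exactOn_transpose_of_sq_eq_bot (h : S.IsAdapted d 0)
    (hm : maximalIdeal A ^ 2 = ⊥) (k : ℕ) (hk : d < k) :
    Matrix.ExactOn ⊤ (S.D k).transpose (S.D (k + 1)).transpose := by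
  refine exactOn_transpose_of_maximalIdeal_sq_eq_bot hm ?_ (S.D_mem k) (h.exact_D k hk)
  refine exists_eq_mul_of_exactOn_transpose (S.T_mul_T 0) (h.exact_T_transpose 0) S.Λ_j S.Λ_mem ?_
  intro u a ha
  -- Since `D i` has entries in `𝔪` and `𝔪² = 0`, the vector `a • v` is a cycle with entries in `𝔪`,
  -- hence a boundary. So `𝔪` kills the cokernels of the `D (i + 1)`, and then that of `T 0`, which
  -- they jointly cover.
  have hD : ∀ (i : ℕ) (v : Fin (c (i + 1)) → A), ∃ w, (S.D (i + 1)).mulVec w = a • v := by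
    intro i v
    refine h.minimal i _ (fun j => Ideal.mul_mem_right _ _ ha) ?_
    rw [Matrix.mulVec_smul]
    ext j
    have : a * (S.D i).mulVec v j ∈ maximalIdeal A ^ 2 := by
      rw [pow_two]
      refine Ideal.mul_mem_mul ha ?_
      rw [Matrix.mulVec, dotProduct]
      exact Ideal.sum_mem _ fun k _ => Ideal.mul_mem_right _ _ (S.D_mem i j k)
    rw [hm] at this
    exact this
  choose w hw using fun i => hD (n i) ((S.U i).mulVec u)
  refine ⟨∑ i, (S.E i).mulVec (w i) + a • S.V.mulVec u, ?_⟩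
  have h1 : a • u = ∑ i, (S.B i).mulVec (a • (S.U i).mulVec u) + (S.T 0).mulVec (a • S.V.mulVec u) := by
    conv_lhs => rw [← Matrix.one_mulVec u, ← S.sum_B_mul_U]
    simp only [Matrix.add_mulVec, Matrix.sum_mulVec, smul_add, Finset.smul_sum, Matrix.mulVec_smul,
      Matrix.mulVec_mulVec]
  rw [h1, Matrix.mulVec_add, Matrix.mulVec_sum]
  congr 1
  refine Finset.sum_congr rfl fun i _ => ?_
  rw [← hw i, Matrix.mulVec_mulVec, Matrix.mulVec_mulVec, S.B_mul_D]

/-- The hypothesis encodes `Hom(k, A) = 0`: a socle element yields a constant vector killed by the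
dual of the minimal matrix `D 1`, hence a vector in the image of a zero module. -/
theorem eq_zero_of_exactOn_transpose (S : SyzygyData A c t n) (hc : c 0 = 0) (hc1 : 0 < c 1)
    (h : Matrix.ExactOn ⊤ (S.D 0).transpose (S.D 1).transpose) (b : A)
    (hb : ∀ y ∈ maximalIdeal A, b * y = 0) : b = 0 := by
  obtain ⟨w, hw⟩ := h (fun _ => b) (fun _ => trivial) (by
    ext i
    rw [Matrix.mulVec, dotProduct]
    refine Finset.sum_eq_zero fun k _ => ?_
    rw [mul_comm]
    exact hb _ (S.D_mem 1 k i))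
  have h0 := congrFun hw ⟨0, hc1⟩
  rw [← h0, Matrix.mulVec, dotProduct]
  exact Finset.sum_eq_zero fun k _ => (Fin.cast hc k).elim0

end SyzygyData

/-- Over a Cohen-Macaulay local ring of minimal multiplicity, the dual of the minimal complex of
adapted data is exact in degrees larger than the dimension. -/
theorem SyzygyData.IsAdapted.exactOn_transpose {c t : ℕ → ℕ} {r : ℕ} {n : Fin r → ℕ} (hc : c 0 = 0)
    (hc1 : 0 < c 1) {d β : ℕ} {s : ℕ} (hs : s ≤ d) {A : Type u} [CommRing A] [IsLocalRing A]
    [IsNoetherianRing A] {S : SyzygyData A c t n} (hS : S.IsAdapted d s)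
    (hdim : ringKrullDim A ≤ s)
    (hβ : β + 1 + s ≤ (Module.length A (A ⧸ maximalIdeal A ^ 2)).toNat + d)
    {P : ℚ[X]} (hP : IsHilbertSamuelPolynomial A P)
    (he : ∀ e : ℚ, e ≠ 0 → backwardDiff^[s] P = C e → e = (β : ℚ) - d + 1) (k : ℕ) (hk : d < k) :
    Matrix.ExactOn ⊤ (S.D k).transpose (S.D (k + 1)).transpose := by
  induction s generalizing A P with
  | zero =>
    have hdim' : ringKrullDim A ≤ 0 := by simpa using hdim
    -- Here the Hilbert-Samuel polynomial is the constant `λ(A)`, so `he` gives `λ(A) = β - d + 1`,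
    -- while `hβ` bounds `λ(A/𝔪²)` below by the same number.
    refine hS.exactOn_transpose_of_sq_eq_bot (maximalIdeal_sq_eq_bot_of_length_le hdim' ?_) k hk
    have : IsArtinianRing A := (isArtinianRing_iff_isNilpotent_maximalIdeal A).mpr
      (isNilpotent_maximalIdeal_of_ringKrullDim_le hdim')
    have h0 : (Module.length A A).toNat ≠ 0 := by
      rw [Ne, ENat.toNat_eq_zero, not_or]
      exact ⟨Module.length_pos.ne', Module.length_ne_top⟩
    have h1 := he _ (Nat.cast_ne_zero.mpr h0) (hilbertSamuelPolynomial_eq_C hP hdim')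
    have h2 : (Module.length A A).toNat + d = β + 1 := by
      have : ((Module.length A A).toNat : ℚ) + d = β + 1 := by rw [h1]; ring
      exact_mod_cast this
    omega
  | succ s ih =>
    have hsoc := S.eq_zero_of_exactOn_transpose hc hc1 (hS.exact_D_transpose 0 (Nat.succ_pos s))
    obtain ⟨x, hxm, hx, n₀, hn₀⟩ := exists_superficial_nagataRing hsoc
    have hx2 := notMem_maximalIdeal_sq hxm hx hn₀
    have : Nontrivial (NagataRing A ⧸ Ideal.span {x}) := by
      rw [Ideal.Quotient.nontrivial_iff]
      intro htop
      rw [Ideal.span_singleton_eq_top] at htop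
      exact hxm htop
    have : IsLocalRing (NagataRing A ⧸ Ideal.span {x}) :=
      IsLocalRing.of_surjective' _ Ideal.Quotient.mk_surjective
    have hA := hS.nagataRing
    have hB := hA.quotient (by omega) hc hxm hx2 hx
    have hreg : x ∈ nonZeroDivisors (NagataRing A) :=
      mem_nonZeroDivisors_iff.mpr ⟨hx, fun z hz => hx z (by rw [mul_comm]; exact hz)⟩
    have hdimB : ringKrullDim (NagataRing A ⧸ Ideal.span {x}) ≤ s := by
      have h1 := ringKrullDim_quotient_span_singleton_succ_eq_ringKrullDim_of_mem_nonZeroDivisors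
        hreg hxm
      rw [ringKrullDim_nagataRing] at h1
      rw [← h1, Nat.cast_succ] at hdim
      exact ENat.WithBot.add_le_add_one_right_iff.mp hdim
    have hβB : β + 1 + s ≤ (Module.length (NagataRing A ⧸ Ideal.span {x})
        ((NagataRing A ⧸ Ideal.span {x}) ⧸
          maximalIdeal (NagataRing A ⧸ Ideal.span {x}) ^ 2)).toNat + d := by
      have h1 := length_quotient_maximalIdeal_sq_le hxm
      rw [length_nagataRing_quotient_maximalIdeal_pow] at h1
      omega
    have hPB := isHilbertSamuelPolynomial_quotient (isHilbertSamuelPolynomial_nagataRing hP) hxm hn₀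
    -- `β` and `d` stay those of the original ring, and `he` is passed on unchanged: `s + 1`
    -- differences of `P` are `s` differences of its backward difference.
    have key := ih (Nat.le_of_succ_le hs) hB hdimB hβB hPB he
    exact Matrix.ExactOn.of_nagataRing (SyzygyData.exactOn_transpose_of_quotient _ hxm hx key)

end IsLocalRing

end

/-! ### Dimension shifting and `Ext` from free resolutions -/

namespace ModuleCat

section DimensionShift

variable {R : Type u} [CommRing R] {X Y Z : Type u} [AddCommGroup X] [Module R X]
  [AddCommGroup Y] [Module R Y] [AddCommGroup Z] [Module R Z]

/-- `Ext` of isomorphic modules. -/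
theorem subsingleton_ext_of_linearEquiv (e : X ≃ₗ[R] Y) (N : ModuleCat.{u} R) {i : ℕ}
    (h : Subsingleton (Ext.{u} (of R Y) N i)) : Subsingleton (Ext.{u} (of R X) N i) := by
  refine subsingleton_of_forall_eq 0 fun x => ?_
  have h1 : x = (Ext.mk₀ e.toModuleIso.hom).comp
      ((Ext.mk₀ e.toModuleIso.inv).comp x (zero_add i)) (zero_add i) := by
    rw [Ext.mk₀_comp_mk₀_assoc, Iso.hom_inv_id, Ext.mk₀_id_comp]
  rw [h1, Subsingleton.elim ((Ext.mk₀ e.toModuleIso.inv).comp x (zero_add i)) 0, Ext.comp_zero]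

variable {f : X →ₗ[R] Y} {g : Y →ₗ[R] Z} (hf : Function.Injective f) (hg : Function.Surjective g)
  (hfg : Function.Exact f g)

include hf hg hfg

theorem shortExact_of_exact :
    (ShortComplex.moduleCatMk f g hfg.linearMap_comp_eq_zero).ShortExact :=
  shortComplex_shortExact _ hfg hf hg

theorem subsingleton_ext_of_exact (N : ModuleCat.{u} R) {i : ℕ}
    (h₁ : Subsingleton (Ext.{u} (of R X) N i)) (h₃ : Subsingleton (Ext.{u} (of R Z) N i)) :
    Subsingleton (Ext.{u} (of R Y) N i) := by
  refine subsingleton_of_forall_eq 0 fun x => ?_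
  have hS := shortExact_of_exact hf hg hfg
  obtain ⟨y, hy⟩ := Ext.contravariant_sequence_exact₂ hS N x (h₁.elim _ _)
  rw [← hy, h₃.elim y 0]
  exact Ext.comp_zero _ _ _ _ _

variable [Module.Projective R Y]

/-- Dimension shift: `Extⁱ⁺¹(Z, N)` vanishes if and only if `Extⁱ(X, N)` does, if `X` is the kernel
of a surjection from a projective module to `Z` and `i ≥ 1`. -/
theorem subsingleton_ext_succ_iff (N : ModuleCat.{u} R) (i : ℕ) :
    Subsingleton (Ext.{u} (of R Z) N (i + 1 + 1)) ↔ Subsingleton (Ext.{u} (of R X) N (i + 1)) := by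
  have hS := shortExact_of_exact hf hg hfg
  have hP : Projective (of R Y) := (IsProjective.iff_projective Y).mp inferInstance
  constructor
  · intro h
    refine subsingleton_of_forall_eq 0 fun x => ?_
    obtain ⟨y, hy⟩ := Ext.contravariant_sequence_exact₁ hS N x (n₁ := i + 1 + 1) (by omega)
      (h.elim _ _)
    have : y = 0 := Ext.eq_zero_of_projective (P := of R Y) y
    rw [← hy, this]
    exact Ext.comp_zero _ _ _ _ _
  · intro h
    refine subsingleton_of_forall_eq 0 fun x => ?_
    obtain ⟨y, hy⟩ := Ext.contravariant_sequence_exact₃ hS N x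
      (Ext.eq_zero_of_projective (P := of R Y) _) (n₀ := i + 1) (by omega)
    rw [← hy, h.elim y 0]
    exact Ext.comp_zero _ _ _ _ _

/-- `Ext¹(Z, N)` vanishes if and only if maps to `N` extend from `X` to `Y`, if `X` is the kernel of
a surjection from the projective module `Y` to `Z`. -/
theorem subsingleton_ext_one_iff (N : Type u) [AddCommGroup N] [Module R N] :
    Subsingleton (Ext.{u} (of R Z) (of R N) 1) ↔ ∀ φ : X →ₗ[R] N, ∃ ψ : Y →ₗ[R] N, ψ ∘ₗ f = φ := by
  have hS := shortExact_of_exact hf hg hfg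
  have hP : Projective (of R Y) := (IsProjective.iff_projective Y).mp inferInstance
  constructor
  · intro h φ
    obtain ⟨y, hy⟩ := Ext.contravariant_sequence_exact₁ hS (of R N)
      (Ext.mk₀ (ModuleCat.ofHom φ)) (n₁ := 1) rfl (h.elim _ _)
    obtain ⟨ψ, rfl⟩ := Ext.homEquiv₀.symm.surjective y
    refine ⟨ψ.hom, ?_⟩
    rw [Ext.homEquiv₀_symm_apply, Ext.mk₀_comp_mk₀] at hy
    have := Ext.homEquiv₀.symm.injective hy
    exact congrArg ModuleCat.Hom.hom this
  · intro h
    refine subsingleton_of_forall_eq 0 fun x => ?_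
    obtain ⟨y, hy⟩ := Ext.contravariant_sequence_exact₃ hS (of R N) x
      (Ext.eq_zero_of_projective (P := of R Y) _) (n₀ := 0) rfl
    obtain ⟨φ, rfl⟩ := Ext.homEquiv₀.symm.surjective y
    obtain ⟨ψ, hψ⟩ := h φ.hom
    rw [← hy]
    have h1 : φ = ModuleCat.ofHom f ≫ ModuleCat.ofHom ψ := by
      ext x; exact (LinearMap.congr_fun hψ x).symm
    have h2 : Ext.homEquiv₀.symm φ =
        (Ext.mk₀ (ShortComplex.moduleCatMk f g hfg.linearMap_comp_eq_zero).f).comp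
          (Ext.mk₀ (ModuleCat.ofHom ψ)) (zero_add 0) := by
      rw [h1]
      exact (Ext.mk₀_comp_mk₀ (ModuleCat.ofHom f) (ModuleCat.ofHom ψ)).symm
    rw [h2]
    exact hS.extClass_comp_assoc _

end DimensionShift

section Resolution

variable {R : Type u} [CommRing R]

/-- `Extⁿ⁺¹(M, N)` computed from a free resolution of `M`. -/
theorem subsingleton_ext_iff_of_resolution (N : Type u) [AddCommGroup N] [Module R N] (n : ℕ)
    {b : ℕ → ℕ} {M : Type u} [AddCommGroup M] [Module R M] (aug : (Fin (b 0) → R) →ₗ[R] M)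
    (δ : ∀ n, (Fin (b (n + 1)) → R) →ₗ[R] (Fin (b n) → R)) (hs : Function.Surjective aug)
    (h0 : Function.Exact (δ 0) aug) (h : ∀ n, Function.Exact (δ (n + 1)) (δ n)) :
    Subsingleton (Ext.{u} (of R M) (of R N) (n + 1)) ↔
      ∀ φ : (Fin (b (n + 1)) → R) →ₗ[R] N, φ ∘ₗ δ (n + 1) = 0 →
        ∃ ψ : (Fin (b n) → R) →ₗ[R] N, ψ ∘ₗ δ n = φ := by
  induction n generalizing b M with
  | zero =>
    have hK : Function.Exact (LinearMap.ker aug).subtype aug := fun x => by simp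
    refine (subsingleton_ext_one_iff (Submodule.subtype_injective _) hs hK N).trans ?_
    let π : (Fin (b 1) → R) →ₗ[R] LinearMap.ker aug :=
      (δ 0).codRestrict _ fun x => h0.apply_apply_eq_zero x
    have hπ : Function.Surjective π := by
      rintro ⟨x, hx⟩
      obtain ⟨y, hy⟩ := (h0 x).mp hx
      exact ⟨y, Subtype.ext hy⟩
    constructor
    · intro H φ hφ
      have hker : LinearMap.ker π ≤ LinearMap.ker φ := by
        intro x hx
        have hx' : δ 0 x = 0 := congrArg Subtype.val hx
        obtain ⟨y, rfl⟩ := (h 0 x).mp hx'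
        exact LinearMap.congr_fun hφ y
      obtain ⟨ψ, hψ⟩ := H (((LinearMap.ker π).liftQ φ hker) ∘ₗ
        (π.quotKerEquivOfSurjective hπ).symm.toLinearMap)
      refine ⟨ψ, ?_⟩
      ext1 i
      ext
      have h1 := LinearMap.congr_fun hψ (π (Pi.single i 1))
      have h2 : (π.quotKerEquivOfSurjective hπ).symm (π (Pi.single i 1)) =
          (LinearMap.ker π).mkQ (Pi.single i 1) := by
        rw [LinearEquiv.symm_apply_eq]; rfl
      simp only [LinearMap.comp_apply, LinearEquiv.coe_coe, h2] at h1
      exact h1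
    · intro H φ
      obtain ⟨ψ, hψ⟩ := H (φ ∘ₗ π) (by
        ext1 i
        ext
        have : π (δ 1 (Pi.single i 1)) = 0 := Subtype.ext ((h 0).apply_apply_eq_zero _)
        simp [this])
      refine ⟨ψ, LinearMap.ext fun x => ?_⟩
      obtain ⟨x, rfl⟩ := hπ x
      exact LinearMap.congr_fun hψ x
  | succ n ih =>
    have hK : Function.Exact (LinearMap.ker aug).subtype aug := fun x => by simp
    rw [subsingleton_ext_succ_iff (Submodule.subtype_injective _) hs hK]
    let π : (Fin (b 1) → R) →ₗ[R] LinearMap.ker aug :=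
      (δ 0).codRestrict _ fun x => h0.apply_apply_eq_zero x
    have hπ : Function.Surjective π := by
      rintro ⟨x, hx⟩
      obtain ⟨y, hy⟩ := (h0 x).mp hx
      exact ⟨y, Subtype.ext hy⟩
    exact ih (b := fun n => b (n + 1)) π (fun n => δ (n + 1)) hπ
      (fun x => by
        rw [← h 0 x]
        exact ⟨fun hx => congrArg Subtype.val hx, fun hx => Subtype.ext hx⟩)
      fun n => h (n + 1)

end Resolution

/-! ### Bounding injective dimension by `Ext` from the residue field -/

section InjectiveDimension

variable {R : Type u} [CommRing R]

/-- The injective dimension of `M` is at most `n` if `Extⁿ⁺¹(R ⧸ I, M) = 0` for all ideals `I`. -/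
theorem hasInjectiveDimensionLE_of_subsingleton_ext (n : ℕ) (M : ModuleCat.{u} R)
    (h : ∀ I : Ideal R, Subsingleton (Ext.{u} (of R (R ⧸ I)) M (n + 1))) :
    HasInjectiveDimensionLE M n := by
  induction n generalizing M with
  | zero =>
    have hB : Module.Baer R M := by
      intro I φ
      have hI : Function.Exact I.subtype I.mkQ := LinearMap.exact_subtype_mkQ I
      obtain ⟨ψ, hψ⟩ := (subsingleton_ext_one_iff (Submodule.subtype_injective I)
        (Submodule.mkQ_surjective I) hI M).mp (h I) φ
      exact ⟨ψ, fun x hx => LinearMap.congr_fun hψ ⟨x, hx⟩⟩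
    have hinj : Injective M := Module.injective_object_of_injective_module R M (inj := hB.injective)
    exact injective_iff_hasInjectiveDimensionLT_one.mp hinj
  | succ n ih =>
    obtain ⟨E, _, f, _⟩ := EnoughInjectives.presentation M
    have hS : (ShortComplex.mk f (Limits.cokernel.π f) (Limits.cokernel.condition f)).ShortExact :=
      { exact := ShortComplex.exact_cokernel f }
    refine (hS.hasInjectiveDimensionLT_X₃_iff n ‹_›).mp (ih _ fun I => ?_)
    refine subsingleton_of_forall_eq 0 fun x => ?_
    obtain ⟨y, hy⟩ := Ext.covariant_sequence_exact₃ (X := of R (R ⧸ I)) hS x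
      (n₁ := n + 1 + 1) rfl ((h I).elim _ _)
    have : y = 0 := Ext.eq_zero_of_injective y
    rw [← hy, this]
    exact Ext.zero_comp _ _ _ _ _

variable [IsLocalRing R] [IsNoetherianRing R]

/-- If `Extⁱ(k, N) = 0` for all `i > d`, then `Extⁱ(M, N) = 0` for all `i > d` and all finitely
generated modules `M`. -/
theorem subsingleton_ext_of_residueField (N : ModuleCat.{u} R) [Module.Finite R N] {d : ℕ}
    (h : ∀ i > d, Subsingleton (Ext.{u} (of R (ResidueField R)) N i)) (M : Type u) [AddCommGroup M]
    [Module R M] [hM : Module.Finite R M] : ∀ i > d, Subsingleton (Ext.{u} (of R M) N i) := by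
  -- Noetherian induction on an ideal `I` annihilating `M`, combined with prime filtrations: the
  -- only new case is `M = R/p` with `p = I`.
  suffices H : ∀ I : Ideal R, ∀ (M : Type u) [AddCommGroup M] [Module R M], Module.Finite R M →
      (∀ a ∈ I, ∀ x : M, a • x = 0) → ∀ i > d, Subsingleton (Ext.{u} (of R M) N i) from
    H ⊥ M hM fun a ha x => by rw [(Submodule.mem_bot R).mp ha, zero_smul]
  intro I
  induction I using IsNoetherian.induction with
  | _ I ih =>
    intro M _ _ hM
    induction hM using IsNoetherianRing.induction_on_isQuotientEquivQuotientPrime R with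
    | subsingleton M =>
      intro _ i _
      refine subsingleton_of_forall_eq 0 fun x => ?_
      have : 𝟙 (of R M) = 0 := by
        ext x; exact Subsingleton.elim _ _
      rw [← Ext.mk₀_id_comp x, this, Ext.mk₀_zero, Ext.zero_comp]
    | quotient M p e =>
      intro hIM i hi
      have hIp : I ≤ p.1 := by
        intro a ha
        have h1 := hIM a ha (e.symm 1)
        rw [← map_smul, LinearEquiv.map_eq_zero_iff, Algebra.smul_def, mul_one] at h1
        exact Ideal.Quotient.eq_zero_iff_mem.mp h1
      refine subsingleton_ext_of_linearEquiv e N ?_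
      rcases hIp.lt_or_eq with hlt | rfl
      · exact ih p.1 hlt (R ⧸ p.1) inferInstance (fun a ha x => by
          obtain ⟨x, rfl⟩ := Ideal.Quotient.mk_surjective x
          rw [Algebra.smul_def]
          exact Ideal.Quotient.eq_zero_iff_mem.mpr (Ideal.mul_mem_right _ _ ha)) i hi
      · by_cases hp : p.1 = maximalIdeal R
        · rw [hp]; exact h i hi
        · have hpm : p.1 < maximalIdeal R :=
            lt_of_le_of_ne (le_maximalIdeal p.2.ne_top) hp
          obtain ⟨x, hxm, hxp⟩ := SetLike.exists_of_lt hpm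
          let f : R ⧸ p.1 →ₗ[R] R ⧸ p.1 := x • LinearMap.id
          have hf : Function.Injective f := by
            rw [← LinearMap.ker_eq_bot, Submodule.eq_bot_iff]
            intro y hy
            obtain ⟨y, rfl⟩ := Ideal.Quotient.mk_surjective y
            have h1 : Ideal.Quotient.mk p.1 (x * y) = 0 := hy
            rw [Ideal.Quotient.eq_zero_iff_mem] at h1 ⊢
            exact (p.2.mem_or_mem h1).resolve_left hxp
          have hC := ih (p.1 ⊔ Ideal.span {x}) (by
            refine lt_of_le_of_ne le_sup_left fun heq => hxp ?_
            rw [heq]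
            exact Ideal.mem_sup_right (Ideal.mem_span_singleton_self x))
            ((R ⧸ p.1) ⧸ LinearMap.range f) inferInstance (by
              intro a ha y
              obtain ⟨y, rfl⟩ := Submodule.mkQ_surjective _ y
              obtain ⟨y, rfl⟩ := Ideal.Quotient.mk_surjective y
              rw [← map_smul, Submodule.mkQ_apply, Submodule.Quotient.mk_eq_zero]
              obtain ⟨b, hb, z, hz, rfl⟩ := Submodule.mem_sup.mp ha
              obtain ⟨z, rfl⟩ := Ideal.mem_span_singleton.mp hz
              refine ⟨Ideal.Quotient.mk p.1 (z * y), ?_⟩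
              have h1 : f (Ideal.Quotient.mk p.1 (z * y)) = Ideal.Quotient.mk p.1 (x * (z * y)) := rfl
              have h2 : (b + x * z) • Ideal.Quotient.mk p.1 y =
                Ideal.Quotient.mk p.1 ((b + x * z) * y) := rfl
              rw [h1, h2, Ideal.Quotient.eq]
              have : x * (z * y) - (b + x * z) * y = -(b * y) := by ring
              rw [this]
              exact neg_mem (Ideal.mul_mem_right _ _ hb)) (1 + i) (by omega)
          have hS := shortExact_of_exact hf (Submodule.mkQ_surjective (LinearMap.range f))
            (LinearMap.exact_map_mkQ_range f)
          -- `Extⁱ⁺¹(R/(p + xR), N) = 0` makes multiplication by `x ∈ 𝔪` surjective on the finitely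
          -- generated module `Extⁱ(R/p, N)`; Nakayama applies.
          have hbot : (⊤ : Submodule R (Ext.{u} (of R (R ⧸ p.1)) N i)) = ⊥ := by
            refine Submodule.eq_bot_of_le_smul_of_le_jacobson_bot (maximalIdeal R) _
              (Module.finite_def.mp inferInstance) ?_ (maximalIdeal_le_jacobson _)
            intro y _
            obtain ⟨z, hz⟩ : ∃ z : Ext.{u} (of R (R ⧸ p.1)) N i,
                (Ext.mk₀ (x • 𝟙 (of R (R ⧸ p.1)))).comp z (zero_add i) = y :=
              Ext.contravariant_sequence_exact₁ hS N y (n₁ := 1 + i) rfl (hC.elim _ _)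
            rw [← hz, Ext.mk₀_smul, Ext.smul_comp, Ext.mk₀_id_comp]
            exact Submodule.smul_mem_smul hxm trivial
          exact (Submodule.subsingleton_iff R).mp (subsingleton_of_bot_eq_top hbot.symm)
    | exact N₁ N₂ N₃ f g hf hg hfg h₁ h₃ =>
      intro hIM i hi
      refine subsingleton_ext_of_exact hf hg hfg N (h₁ (fun a ha x => hf ?_) i hi)
        (h₃ (fun a ha x => ?_) i hi)
      · rw [map_smul, hIM a ha, map_zero]
      · obtain ⟨x, rfl⟩ := hg x
        rw [← map_smul, hIM a ha, map_zero]

end InjectiveDimension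

end ModuleCat

/-! ### Free resolutions and their matrices -/

section FreeResolution

variable {R : Type u} [CommRing R]

/-- Exactness of the dual of a pair of maps of free modules, in terms of functionals. -/
theorem Matrix.exactOn_transpose_toMatrix'_iff {a b c : ℕ} (f : (Fin b → R) →ₗ[R] (Fin a → R))
    (g : (Fin c → R) →ₗ[R] (Fin b → R)) :
    Matrix.ExactOn ⊤ (LinearMap.toMatrix' f).transpose (LinearMap.toMatrix' g).transpose ↔
      ∀ φ : (Fin b → R) →ₗ[R] R, φ ∘ₗ g = 0 → ∃ ψ : (Fin a → R) →ₗ[R] R, ψ ∘ₗ f = φ := by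
  have key : ∀ {p q : ℕ} (h : (Fin p → R) →ₗ[R] (Fin q → R)) (u : Fin q → R) (i : Fin p),
      (LinearMap.toMatrix' h).transpose.mulVec u i =
        (Fintype.linearCombination R u ∘ₗ h) (Pi.single i 1) := by
    intro p q h u i
    simp [Matrix.mulVec, dotProduct, Fintype.linearCombination_apply, LinearMap.toMatrix'_apply]
  have hrep : ∀ {q : ℕ} (φ : (Fin q → R) →ₗ[R] R),
      φ = Fintype.linearCombination R fun i => φ (Pi.single i 1) := by
    intro q φ
    ext i
    simp [Fintype.linearCombination_apply_single]
  have hz : ∀ {p q : ℕ} (h : (Fin p → R) →ₗ[R] (Fin q → R)) (u : Fin q → R) (v : Fin p → R),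
      (LinearMap.toMatrix' h).transpose.mulVec u = v ↔
        Fintype.linearCombination R u ∘ₗ h = Fintype.linearCombination R v := by
    intro p q h u v
    constructor
    · intro H
      ext i
      have := congrFun H i
      rw [key] at this
      simpa using this
    · intro H
      ext i
      rw [key, H]
      simp [Fintype.linearCombination_apply_single]
  constructor
  · intro H φ hφ
    obtain ⟨w, hw⟩ := H (fun i => φ (Pi.single i 1)) (fun _ => trivial) (by
      rw [hz, ← hrep, hφ]; ext; simp)
    exact ⟨_, ((hz _ _ _).mp hw).trans (hrep φ).symm⟩
  · intro H u _ hu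
    obtain ⟨ψ, hψ⟩ := H (Fintype.linearCombination R u) (by
      rw [(hz _ _ _).mp hu]; ext; simp)
    rw [hrep ψ] at hψ
    exact ⟨_, (hz _ _ _).mpr hψ⟩

theorem Matrix.exactOn_toMatrix'_iff {a b c : ℕ} (f : (Fin b → R) →ₗ[R] (Fin a → R))
    (g : (Fin c → R) →ₗ[R] (Fin b → R)) (h : Function.Exact g f) (I : Ideal R) :
    Matrix.ExactOn I (LinearMap.toMatrix' g) (LinearMap.toMatrix' f) := by
  intro u _ hu
  rw [LinearMap.toMatrix'_mulVec] at hu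
  obtain ⟨w, hw⟩ := (h u).mp hu
  exact ⟨w, by rw [LinearMap.toMatrix'_mulVec, hw]⟩

variable [IsNoetherianRing R]

/-- A finitely generated module over a Noetherian ring has a resolution by finite free modules. -/
theorem Module.Finite.exists_freeResolution (M : Type u) [AddCommGroup M] [Module R M]
    [Module.Finite R M] : ∃ (t : ℕ → ℕ) (aug : (Fin (t 0) → R) →ₗ[R] M)
      (τ : ∀ n, (Fin (t (n + 1)) → R) →ₗ[R] (Fin (t n) → R)), Function.Surjective aug ∧
        Function.Exact (τ 0) aug ∧ ∀ n, Function.Exact (τ (n + 1)) (τ n) := by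
  have hcover : ∀ K : (Σ a : ℕ, Submodule R (Fin a → R)), ∃ (b : ℕ)
      (g : (Fin b → R) →ₗ[R] (Fin K.1 → R)), LinearMap.range g = K.2 := by
    intro K
    obtain ⟨b, g, hg⟩ := Module.Finite.exists_fin' R K.2
    exact ⟨b, K.2.subtype ∘ₗ g, by
      rw [LinearMap.range_comp, LinearMap.range_eq_top.mpr hg, Submodule.map_top,
        Submodule.range_subtype]⟩
  choose b g hg using hcover
  obtain ⟨a, aug, haug⟩ := Module.Finite.exists_fin' R M
  -- Each stage stores a rank together with the kernel that the next map has to cover.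
  let K : ℕ → Σ a : ℕ, Submodule R (Fin a → R) := fun n =>
    Nat.rec ⟨a, LinearMap.ker aug⟩ (fun _ K => ⟨b K, LinearMap.ker (g K)⟩) n
  refine ⟨fun n => (K n).1, aug, fun n => g (K n), haug, ?_, fun n => ?_⟩
  · exact LinearMap.exact_iff.mpr (hg (K 0)).symm
  · exact LinearMap.exact_iff.mpr (hg (K (n + 1))).symm

/-- A nonzero quotient of a free module of finite rank over a local ring has a functional with
values in the residue field; here it is lifted to the free module and normalised. -/
theorem IsLocalRing.exists_functional_mem_maximalIdeal [IsLocalRing R] {L : Type u}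
    [AddCommGroup L] [Module R L] [Nontrivial L] {a : ℕ} {aug : (Fin a → R) →ₗ[R] L}
    (haug : Function.Surjective aug) : ∃ (Λ : Fin a → R) (j : Fin a), Λ j = 1 ∧
      ∀ x, aug x = 0 → ∑ i, x i * Λ i ∈ maximalIdeal R := by
  have : Module.Finite R L := Module.Finite.of_surjective aug haug
  obtain ⟨N, hN, -⟩ := IsCoatomic.eq_top_or_exists_le_coatom (⊥ : Submodule R L) |>.resolve_left
    bot_ne_top
  have hsimple : IsSimpleModule R (L ⧸ N) := isSimpleModule_iff_isCoatom.mpr hN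
  obtain ⟨I, hI, ⟨e⟩⟩ := isSimpleModule_iff_quot_maximal.mp hsimple
  obtain rfl := eq_maximalIdeal hI
  let lam : (Fin a → R) →ₗ[R] R ⧸ maximalIdeal R := e.toLinearMap ∘ₗ N.mkQ ∘ₗ aug
  have hlam : Function.Surjective lam :=
    e.surjective.comp ((Submodule.mkQ_surjective N).comp haug)
  choose Λ₀ hΛ₀ using fun i => Ideal.Quotient.mk_surjective (lam (Pi.single i 1))
  have hrep : ∀ x, lam x = Ideal.Quotient.mk _ (∑ i, x i * Λ₀ i) := by
    intro x
    conv_lhs => rw [← Finset.univ_sum_single x]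
    rw [map_sum, map_sum]
    refine Finset.sum_congr rfl fun i _ => ?_
    have : Pi.single i (x i) = x i • (Pi.single i 1 : Fin a → R) := by
      rw [← Pi.single_smul, smul_eq_mul, mul_one]
    rw [this, map_smul, ← hΛ₀ i, map_mul]
    rfl
  obtain ⟨j, hj⟩ : ∃ j, Λ₀ j ∉ maximalIdeal R := by
    by_contra! H
    obtain ⟨x, hx⟩ := hlam 1
    rw [hrep, Ideal.Quotient.eq_zero_iff_mem.mpr
      (Ideal.sum_mem _ fun i _ => Ideal.mul_mem_left _ _ (H i))] at hx
    exact zero_ne_one hx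
  obtain ⟨v, hv⟩ := (notMem_maximalIdeal.mp hj).exists_left_inv
  refine ⟨fun i => v * Λ₀ i, j, hv, fun x hx => ?_⟩
  have h1 : lam x = 0 := by simp [lam, hx]
  rw [hrep, Ideal.Quotient.eq_zero_iff_mem] at h1
  have h2 : ∑ i, x i * (v * Λ₀ i) = v * ∑ i, x i * Λ₀ i := by
    rw [Finset.mul_sum]
    exact Finset.sum_congr rfl fun i _ => by ring
  rw [h2]
  exact Ideal.mul_mem_left _ _ h1

end FreeResolution

/-! ### Vanishing of `Ext` below the depth -/

namespace IsLocalRing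

variable {R : Type u} [CommRing R] [IsLocalRing R] [IsNoetherianRing R]

/-- `Extⁱ(k, R)` vanishes for `i` less than the dimension of a Cohen-Macaulay local ring `R`. -/
theorem _root_.IsCohenMacaulayLocal.subsingleton_ext_residueField (h : IsCohenMacaulayLocal R)
    {d : ℕ} (hd : ringKrullDim R = d) (i : ℕ) (hi : i < d) :
    Subsingleton (Ext.{u} (ModuleCat.of R (ResidueField R)) (ModuleCat.of R R) i) := by
  have h1 : localRingDepth R = d := by
    have : (localRingDepth R : WithBot ℕ∞) = ((d : ℕ∞) : WithBot ℕ∞) := h.trans hd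
    exact WithBot.coe_injective this
  have : (i : ℕ∞) < localRingDepth R := by rw [h1]; exact_mod_cast hi
  obtain ⟨⟨rs, hrs, hreg⟩, hlt⟩ := lt_iSup_iff.mp this
  have hlt : i < rs.length := by exact_mod_cast hlt
  refine ModuleCat.subsingleton_ext_of_exists_isRegular (maximalIdeal R)
    (ModuleCat.of R (ResidueField R)) ?_ (ModuleCat.of R R) ?_ rs hrs hreg i hlt
  · rw [Module.support_eq_zeroLocus]
    refine PrimeSpectrum.zeroLocus_anti_mono ?_
    change ((maximalIdeal R : Ideal R) : Set R) ⊆ (Module.annihilator R (R ⧸ maximalIdeal R))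
    rw [Ideal.annihilator_quotient]
  · change maximalIdeal R • (⊤ : Submodule R R) < ⊤
    rw [smul_eq_mul, Ideal.mul_top]
    exact lt_top_iff_ne_top.mpr (maximalIdeal.isMaximal R).ne_top

end IsLocalRing

/-! ### Matrix data from the minimal resolution -/

namespace MinimalFreeResolution

section Syzygy

variable {R : Type u} [CommRing R] [IsLocalRing R] {M : Type u} [AddCommGroup M] [Module R M]
  (F : MinimalFreeResolution R M)

/-- The ranks of the free modules, in degrees raised by one. -/
def augRank : ℕ → ℕ
  -- With the zero module below `F₀`, exactness of the dual at `F₀` expresses `Hom(k, R) = 0`.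
  | 0 => 0
  | n + 1 => F.rank n

/-- The matrices of the differentials, in degrees raised by one. -/
noncomputable def diffMatrix : ∀ n, Matrix (Fin (F.augRank n)) (Fin (F.augRank (n + 1))) R
  | 0 => 0
  | n + 1 => LinearMap.toMatrix' (F.diff n)

/-- The projection of a free module of the resolution onto the syzygy module. -/
noncomputable def syzygyCover : ∀ n, (Fin (F.rank n) → R) →ₗ[R] F.syzygy n
  | 0 => F.aug.rangeRestrict
  | n + 1 => (F.diff n).rangeRestrict

theorem syzygyCover_surjective : ∀ n, Function.Surjective (F.syzygyCover n)
  | 0 => F.aug.surjective_rangeRestrict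
  | n + 1 => (F.diff n).surjective_rangeRestrict

theorem syzygyCover_diff (n : ℕ) (x) : F.syzygyCover n (F.diff n x) = 0 := by
  cases n with
  | zero => exact Subtype.ext (F.exact_zero.apply_apply_eq_zero x)
  | succ n => exact Subtype.ext ((F.exact_succ n).apply_apply_eq_zero x)

theorem diffMatrix_mul_diffMatrix (n : ℕ) : F.diffMatrix n * F.diffMatrix (n + 1) = 0 := by
  cases n with
  | zero => exact Matrix.zero_mul _
  | succ n =>
    exact (LinearMap.toMatrix'_comp (F.diff n) (F.diff (n + 1))).symm.trans (by
      rw [(F.exact_succ n).linearMap_comp_eq_zero, map_zero]; rfl)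

theorem diffMatrix_mem (n i k) : F.diffMatrix n i k ∈ maximalIdeal R := by
  cases n with
  | zero => exact zero_mem _
  | succ n =>
    have h : maximalIdeal R • (⊤ : Submodule R (Fin (F.rank n) → R)) ≤
        Submodule.pi Set.univ fun _ => maximalIdeal R :=
      Submodule.smul_le.mpr fun a ha x _ j _ => Ideal.mul_mem_right _ _ ha
    have := h (F.minimal n ⟨Pi.single k 1, rfl⟩) i trivial
    have h1 : F.diffMatrix (n + 1) i k = F.diff n (Pi.single k 1) i :=
      LinearMap.toMatrix'_apply (F.diff n) i k
    rwa [h1]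

theorem exactOn_diffMatrix (n : ℕ) (hn : 0 < n) (I : Ideal R) :
    Matrix.ExactOn I (F.diffMatrix (n + 1)) (F.diffMatrix n) := by
  cases n with
  | zero => omega
  | succ n => exact Matrix.exactOn_toMatrix'_iff (F.diff n) (F.diff (n + 1)) (F.exact_succ n) I

/-- The map given by the free resolution of a module on a sum of copies of syzygy modules, as
matrices. -/
theorem exists_syzygyData [IsNoetherianRing R] {r : ℕ} (n : Fin r → ℕ)
    {L : Type u} [AddCommGroup L] [Module R L] [Nontrivial L]
    (f : DirectSum (Fin r) (fun i => F.syzygy (n i)) →ₗ[R] L) (hf : Function.Surjective f)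
    {t : ℕ → ℕ} {aug : (Fin (t 0) → R) →ₗ[R] L}
    {τ : ∀ n, (Fin (t (n + 1)) → R) →ₗ[R] (Fin (t n) → R)} (haug : Function.Surjective aug)
    (h0 : Function.Exact (τ 0) aug) (h : ∀ n, Function.Exact (τ (n + 1)) (τ n)) :
    ∃ S : SyzygyData R F.augRank t n, S.D = F.diffMatrix ∧
      S.T = fun n => LinearMap.toMatrix' (τ n) := by
  let γ : ∀ i, (Fin (F.rank (n i)) → R) →ₗ[R] L := fun i =>
    f ∘ₗ DirectSum.lof R (Fin r) (fun i => F.syzygy (n i)) i ∘ₗ F.syzygyCover (n i)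
  have hγ : ∀ x : L, ∃ v : ∀ i, Fin (F.rank (n i)) → R, ∑ i, γ i (v i) = x := by
    intro x
    obtain ⟨y, rfl⟩ := hf x
    choose v hv using fun i => F.syzygyCover_surjective (n i) (y i)
    refine ⟨v, ?_⟩
    simp only [γ, LinearMap.comp_apply, hv]
    rw [← map_sum]
    congr 1
    exact DirectSum.sum_univ_of y
  choose b hb using fun i => Module.projective_lifting_property aug (γ i) haug
  have hE : ∀ i, ∃ e : (Fin (F.rank (n i + 1)) → R) →ₗ[R] (Fin (t 1) → R),
      τ 0 ∘ₗ e = b i ∘ₗ F.diff (n i) := by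
    intro i
    let ρ : (Fin (t 1) → R) →ₗ[R] LinearMap.ker aug :=
      (τ 0).codRestrict _ fun x => h0.apply_apply_eq_zero x
    have hρ : Function.Surjective ρ := by
      rintro ⟨x, hx⟩
      obtain ⟨y, hy⟩ := (h0 x).mp hx
      exact ⟨y, Subtype.ext hy⟩
    obtain ⟨e, he⟩ := Module.projective_lifting_property ρ
      ((b i ∘ₗ F.diff (n i)).codRestrict (LinearMap.ker aug) fun x => by
        have := LinearMap.congr_fun (hb i) (F.diff (n i) x)
        simpa [γ, F.syzygyCover_diff] using this) hρ
    exact ⟨e, LinearMap.ext fun x => congrArg Subtype.val (LinearMap.congr_fun he x)⟩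
  choose e he using hE
  -- Surjectivity of `f`: each basis vector of the free cover of `L` is a sum of values of the `b i`
  -- up to a relation `τ 0 w`. The vectors `v` and `w` become the columns of `U` and `V`.
  choose v hv using fun l : Fin (t 0) => hγ (aug (Pi.single l 1))
  have hw : ∀ l : Fin (t 0), ∃ w, τ 0 w = Pi.single l 1 - ∑ i, b i (v l i) := by
    intro l
    refine (h0 _).mp ?_
    rw [map_sub, map_sum, ← hv l, sub_eq_zero]
    exact Finset.sum_congr rfl fun i _ => (LinearMap.congr_fun (hb i) _).symm
  choose w hw using hw
  obtain ⟨Λ, j, hj, hΛ⟩ := exists_functional_mem_maximalIdeal haug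
  refine ⟨{
    D := F.diffMatrix
    T := fun n => LinearMap.toMatrix' (τ n)
    B := fun i => LinearMap.toMatrix' (b i)
    E := fun i => LinearMap.toMatrix' (e i)
    U := fun i => Matrix.of fun p l => v l i p
    V := Matrix.of fun p l => w l p
    Λ := Λ
    j := j
    D_mul_D := F.diffMatrix_mul_diffMatrix
    D_mem := F.diffMatrix_mem
    T_mul_T := fun n => by
      rw [← LinearMap.toMatrix'_comp, (h n).linearMap_comp_eq_zero, map_zero]
    B_mul_D := fun i => (LinearMap.toMatrix'_comp (b i) (F.diff (n i))).symm.trans (by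
      rw [← he i, LinearMap.toMatrix'_comp]
      rfl)
    sum_B_mul_U := ?_
    Λ_j := hj
    Λ_mem := fun i => ?_ }, rfl, rfl⟩
  · ext q l
    have h1 : ∀ i, (LinearMap.toMatrix' (b i) * (Matrix.of fun p l => v l i p)) q l =
        b i (v l i) q := fun i => congrFun (LinearMap.toMatrix'_mulVec (b i) (v l i)) q
    have h2 : (LinearMap.toMatrix' (τ 0) * (Matrix.of fun p l => w l p)) q l =
        τ 0 (w l) q := congrFun (LinearMap.toMatrix'_mulVec (τ 0) (w l)) q
    rw [Matrix.add_apply, Matrix.sum_apply, h2, hw l, Pi.sub_apply, Finset.sum_apply]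
    refine (congrArg₂ (· + ·) (Finset.sum_congr rfl fun i _ => h1 i) rfl).trans ?_
    simp [Matrix.one_apply, Pi.single_apply]
  · have := hΛ (τ 0 (Pi.single i 1)) (h0.apply_apply_eq_zero _)
    simpa [Matrix.mulVec, dotProduct, LinearMap.toMatrix'_apply] using this

end Syzygy

section ResidueField

variable {R : Type u} [CommRing R] [IsLocalRing R]
  (F : MinimalFreeResolution R (ResidueField R))

/-- In degree zero, the augmentation kills vectors with entries in `𝔪`, because `𝔪` kills `k`. -/
theorem exactOn_maximalIdeal_diffMatrix (n : ℕ) :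
    Matrix.ExactOn (maximalIdeal R) (F.diffMatrix (n + 1)) (F.diffMatrix n) := by
  cases n with
  | succ n => exact F.exactOn_diffMatrix (n + 1) n.succ_pos _
  | zero =>
    intro u hu _
    change Fin (F.rank 0) → R at u
    have h1 : F.aug u = 0 := by
      rw [← Finset.univ_sum_single u, map_sum]
      refine Finset.sum_eq_zero fun i _ => ?_
      have h2 : Pi.single i (u i) = u i • (Pi.single i 1 : Fin (F.rank 0) → R) := by
        rw [← Pi.single_smul, smul_eq_mul, mul_one]
      have h3 : residue R (u i) = 0 := (residue_eq_zero_iff _).mpr (hu i)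
      rw [h2, map_smul, Algebra.smul_def]
      exact (congrArg (· * _) h3).trans (zero_mul _)
    obtain ⟨w, hw⟩ := (F.exact_zero u).mp h1
    exact ⟨w, (LinearMap.toMatrix'_mulVec (F.diff 0) w).trans hw⟩

theorem rank_zero_pos : 0 < F.rank 0 := by
  obtain ⟨x, hx⟩ := F.aug_surjective 1
  by_contra! h
  have : IsEmpty (Fin (F.rank 0)) := ⟨fun i => absurd i.2 (by omega)⟩
  rw [Subsingleton.elim x 0, map_zero] at hx
  exact zero_ne_one hx

theorem subsingleton_ext_succ_iff_exactOn (n : ℕ) :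
    Subsingleton (Ext.{u} (ModuleCat.of R (ResidueField R)) (ModuleCat.of R R) (n + 1)) ↔
      Matrix.ExactOn ⊤ (F.diffMatrix (n + 1)).transpose (F.diffMatrix (n + 1 + 1)).transpose :=
  (ModuleCat.subsingleton_ext_iff_of_resolution R n F.aug F.diff F.aug_surjective F.exact_zero
    F.exact_succ).trans (Matrix.exactOn_transpose_toMatrix'_iff (F.diff n) (F.diff (n + 1))).symm

/-- In degree zero, a functional vanishing on the image of `F₁` factors through `k`, and `Hom(k, R)
= 0`. -/
theorem exactOn_transpose_diffMatrix_of_subsingleton_ext (n : ℕ)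
    (h : Subsingleton (Ext.{u} (ModuleCat.of R (ResidueField R)) (ModuleCat.of R R) n)) :
    Matrix.ExactOn ⊤ (F.diffMatrix n).transpose (F.diffMatrix (n + 1)).transpose := by
  cases n with
  | succ n => exact (F.subsingleton_ext_succ_iff_exactOn n).mp h
  | zero =>
    have h1 : (F.diffMatrix 0).transpose =
        (LinearMap.toMatrix' (0 : (Fin (F.rank 0) → R) →ₗ[R] (Fin 0 → R))).transpose := by
      rw [map_zero]; rfl
    rw [h1]
    refine (Matrix.exactOn_transpose_toMatrix'_iff _ (F.diff 0)).mpr fun φ hφ => ⟨0, ?_⟩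
    have hker : LinearMap.ker F.aug ≤ LinearMap.ker φ := by
      intro x hx
      obtain ⟨y, rfl⟩ := (F.exact_zero x).mp hx
      exact LinearMap.congr_fun hφ y
    let φ' : ResidueField R →ₗ[R] R := ((LinearMap.ker F.aug).liftQ φ hker) ∘ₗ
      (F.aug.quotKerEquivOfSurjective F.aug_surjective).symm.toLinearMap
    have h2 : φ' = 0 := by
      have h3 : (ModuleCat.ofHom φ') = ModuleCat.ofHom 0 :=
        Ext.homEquiv₀.symm.injective (h.elim _ _)
      exact congrArg ModuleCat.Hom.hom h3
    rw [LinearMap.zero_comp]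
    ext1 i
    ext
    have h4 : (F.aug.quotKerEquivOfSurjective F.aug_surjective).symm (F.aug (Pi.single i 1)) =
        (LinearMap.ker F.aug).mkQ (Pi.single i 1) := by
      rw [LinearEquiv.symm_apply_eq]; rfl
    have h5 := LinearMap.congr_fun h2 (F.aug (Pi.single i 1))
    simp only [φ', LinearMap.comp_apply, LinearEquiv.coe_coe, h4] at h5
    exact h5.symm

end ResidueField

end MinimalFreeResolution

/-! ### The theorem -/

theorem corollary5p3 {R : Type u} [CommRing R] [IsLocalRing R] [IsNoetherianRing R]
    (hCM : IsCohenMacaulayLocal R) (hmult : HasMinimalMultiplicity R)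
    (F : MinimalFreeResolution R (IsLocalRing.ResidueField R))
    {r : ℕ} (n : Fin r → ℕ)
    {L : Type u} [AddCommGroup L] [Module R L] [Nontrivial L] (hL : IsGDimZero R L)
    (f : DirectSum (Fin r) (fun i => F.syzygy (n i)) →ₗ[R] L) (hf : Function.Surjective f) :
    IsGorensteinLocal R := by
  obtain ⟨d, hd, d', P, hd', hP, he⟩ := hmult
  obtain rfl : d = d' := by exact_mod_cast hd.symm.trans hd'
  have : ∀ m, Module.Finite R (F.syzygy m) := fun m =>
    Module.Finite.of_surjective _ (F.syzygyCover_surjective m)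
  have : Module.Finite R L := Module.Finite.of_surjective f hf
  obtain ⟨t, aug, τ, haug, h0, h⟩ := Module.Finite.exists_freeResolution (R := R) L
  obtain ⟨S, hSD, hST⟩ := F.exists_syzygyData n f hf haug h0 h
  -- The induction starts at `s = d`: `F` is exact in positive degrees, its dual is exact below the
  -- depth `d`, and `Extⁱ(L, R) = 0` makes the dual of the resolution of `L` exact.
  have hS : S.IsAdapted d d := by
    refine ⟨fun m => ?_, fun m hm => ?_, fun m hm => ?_, fun m => ?_⟩
    · rw [hSD]; exact F.exactOn_maximalIdeal_diffMatrix m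
    · rw [hSD]; exact F.exactOn_diffMatrix m (by omega) ⊤
    · rw [hSD]
      exact F.exactOn_transpose_diffMatrix_of_subsingleton_ext m
        (hCM.subsingleton_ext_residueField hd m hm)
    · rw [hST]
      exact (Matrix.exactOn_transpose_toMatrix'_iff (τ m) (τ (m + 1))).mpr
        ((ModuleCat.subsingleton_ext_iff_of_resolution R m aug τ haug h0 h).mp
          (hL.ext_eq_zero (m + 1) m.succ_pos))
  -- At the start the bound on `λ(R/𝔪²)` is an equality, and a non-zero constant `d`-th difference
  -- is `d!` times the leading coefficient, that is, `e(R)`.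
  have key := hS.exactOn_transpose rfl F.rank_zero_pos le_rfl hd.le
    (β := (maximalIdeal R).spanFinrank) (by rw [length_quotient_maximalIdeal_sq]) hP
    fun e hne hPe => by
      rw [he]
      exact (Polynomial.factorial_mul_leadingCoeff_of_backwardDiff_iterate hne hPe).2.symm
  refine ⟨d, ModuleCat.hasInjectiveDimensionLE_of_subsingleton_ext d _ fun I => ?_⟩
  refine ModuleCat.subsingleton_ext_of_residueField (ModuleCat.of R R) (d := d) (fun i hi => ?_)
    (R ⧸ I) (d + 1) (Nat.lt_succ_self d)
  obtain ⟨i, rfl⟩ : ∃ j, i = j + 1 := ⟨i - 1, by omega⟩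
  have := key (i + 1) hi
  rw [hSD] at this
  exact (F.subsingleton_ext_succ_iff_exactOn i).mpr this
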